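/- Let $(Y_i,X_i,Z_i)$, $i\ge 1$, be i.i.d. random variables with values in measurable spaces $\mathcal Y\times\mathcal X\times\mathcal Z$ and law $O$. Let $P$ be the law of $W_i=(Y_i,X_i)$ and $Q$ the law of $Z_i$. Suppose that $O$ has a density $p(w,z)$ with respect to a product $\mu\otimes\nu$ of $\sigma$-finite measures on $\mathcal Y\times\mathcal X$ and $\mathcal Z$ (for example Lebesgue measures). Let $p(w)=\int p(w,z)\,d\nu(z)$ and $p(z)=\int p(w,z)\,d\mu(w)$ be the marginal densities, and let $$r^*(w|z)=\frac{p(w,z)}{p(w)\,p(z)}\qquad (P\otimes Q\text{-almost everywhere})$$ be the conditional density ratio. Let $\mathcal R$ be a class of measurable functions on $(\mathcal Y\times\mathcal X)\times\mathcal Z$ such that $\mathcal R$ is a Vapnik–Chervonenkis class (the subgraphs $\{(x,t):t<r(x)\}$, $r\in\mathcal R$, form a VC class of sets), $r^*\in\mathcal R$, and $|r|\le B$ for all $r\in\mathcal R$, where $0<B<\infty$. Let $I$ be a functional with values in $[0,\infty]$ and $I(r^*)<\infty$; put $\mathcal R_M=\{r\in\mathcal R: I(r)\le M\}$ and suppose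 that $\mathcal R=\bigcup_{M\ge 1}\mathcal R_M$. Suppose that there are $0<\gamma<2$ and a constant $A$ such that $$\log \mathcal N(\delta,\mathcal R_M,\|\cdot\|_\infty)\le A\,(M/\delta)^\gamma\qquad\text{for all } M\ge 1,\ \delta>0,$$ where $\mathcal N(\delta,\mathcal R_M,\|\cdot\|_\infty)$ is the least number of closed balls of radius $\delta$ in the norm $\|f\|_\infty=\sup_x|f(x)|$ that cover $\mathcal R_M$. For every $n\ge1$ let $\hat r=\hat r_n$ almost surely be a minimizer over $r\in\mathcal R$ of $$-\frac1n\sum_{i=1}^n r(W_i|Z_i)+\frac12\,\frac1n\sum_{j=1}^n\frac1n\sum_{i=1}^n r^2(W_i|Z_j).$$ Then, as $n\to\infty$, $$\|\hat r-r^*\|_{L^2(O)}=O_p\bigl(n^{-1/(2+\gamma)}\bigr)\qquad\text{and}\qquad \|\hat r-r^*\|_{L^2(P\otimes Q)}=O_p\bigl(n^{-1/(2+\gamma)}\bigr).$$ -/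

import Mathlib

open MeasureTheory ProbabilityTheory Filter
open scoped ENNReal NNReal UniformConvergence

noncomputable section

/-- The density ratio `p(w, z) / (p(w) p(z))` of a joint density `p` with respect to `μ ⊗ ν`, where
`p(w) = ∫ p(w, z) dν(z)` and `p(z) = ∫ p(w, z) dμ(w)` are the marginal densities. -/
def densityRatio {α β : Type*} [MeasurableSpace α] [MeasurableSpace β] (μ : Measure α)
    (ν : Measure β) (p : α × β → ℝ≥0∞) (q : α × β) : ℝ :=
  (p q / ((∫⁻ z, p (q.1, z) ∂ν) * ∫⁻ w, p (w, q.2) ∂μ)).toReal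

/-- A class `C` of sets shatters a finite set `s` if every subset of `s` is of the form `c ∩ s`
with `c ∈ C`. -/
def ShattersSet {α : Type*} (C : Set (Set α)) (s : Finset α) : Prop :=
  ∀ t : Set α, t ⊆ (s : Set α) → ∃ c ∈ C, c ∩ (s : Set α) = t

/-- A Vapnik-Chervonenkis class of sets: for some `d`, no set of more than `d` points is
shattered. -/
def IsVCClass {α : Type*} (C : Set (Set α)) : Prop :=
  ∃ d : ℕ, ∀ s : Finset α, d < s.card → ¬ ShattersSet C s

/-- The subgraph `{(x, t) : t < f x}` of a real function. -/
def subgraph {α : Type*} (f : α → ℝ) : Set (α × ℝ) := {a | a.2 < f a.1}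

/-- A Vapnik-Chervonenkis (subgraph) class of functions: the subgraphs form a VC class of sets. -/
def IsVCFunctionClass {α : Type*} (F : Set (α → ℝ)) : Prop :=
  IsVCClass (subgraph '' F)

/-- The covering number of a class of real functions in the sup norm: the least number of closed
sup-norm balls of radius `δ`, centred at arbitrary functions, that cover the class. -/
def supCoveringNumber {α : Type*} (δ : ℝ≥0) (F : Set (α → ℝ)) : ℕ∞ :=
  Metric.externalCoveringNumber δ ((UniformFun.ofFun : (α → ℝ) → (α →ᵤ ℝ)) '' F)

/-- The sub-class of the functions in `R` of complexity `I` at most `M`. -/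
def stratum {α : Type*} (R : Set (α → ℝ)) (I : (α → ℝ) → ℝ≥0∞) (M : ℝ) : Set (α → ℝ) :=
  {r ∈ R | I r ≤ ENNReal.ofReal M}

/-- The empirical least-squares risk
`- (1/n) ∑ᵢ r(Wᵢ, Zᵢ) + (1/2) (1/n) ∑ⱼ (1/n) ∑ᵢ r(Wᵢ, Zⱼ)²` of the first `n` data points. -/
def lsifRisk {α β : Type*} (n : ℕ) (W : ℕ → α) (Z : ℕ → β) (r : α × β → ℝ) : ℝ :=
  -((1 / (n : ℝ)) * ∑ i ∈ Finset.range n, r (W i, Z i))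
    + (1 / 2) * ((1 / (n : ℝ)) * ∑ j ∈ Finset.range n,
        (1 / (n : ℝ)) * ∑ i ∈ Finset.range n, (r (W i, Z j)) ^ 2)

/-- `U n = O_p(a n)`: for every `ε > 0` there is `C > 0` such that `U n > C * a n` has probability
at most `ε` for all large `n`. (For events that are not measurable, `P` is the outer measure.) -/
def IsBigOInProbability {Ω : Type*} [MeasurableSpace Ω] (P : Measure Ω) (U : ℕ → Ω → ℝ≥0∞)
    (a : ℕ → ℝ) : Prop :=
  ∀ ε : ℝ, 0 < ε → ∃ C : ℝ, 0 < C ∧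
    ∀ᶠ n in atTop, P {ω | ENNReal.ofReal (C * a n) < U n ω} ≤ ENNReal.ofReal ε

end

/-!
The Vapnik-Chervonenkis property alone gives the rate `(log n / n) ^ (1 / 2)`, up to a constant, which
is faster than `n ^ (-1 / (2 + γ))` for every `γ > 0`. The sup-norm entropy bound serves to make the
class separable in the sup norm, so that suprema over it reduce to countable ones and no
measurability question arises.

Write `P`, `Q` for the marginals of `O`. Since `O = r* (P ⊗ Q)`, the population excess risk of `r` is
`‖r - r*‖² / 2` in `L²(P ⊗ Q)`. Up to a term of order `1 / n` from the diagonal, the empirical excess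
risk is a U-statistic of order two, whose kernel `excessLoss r* r` satisfies the Bernstein condition
`∫ g² ≤ c ∫ g` (`integral_excessLoss_sq_le`). As the estimator has nonpositive empirical excess
risk, it suffices to bound the expectation of `sup_r (∫ g_r - 2 U g_r)` by `C n ^ (-a)` for
`a = 2 / (2 + γ) < 1`; Markov's inequality then concludes.

The bound on the expected supremum, taken first over finite subclasses, has three ingredients.
* Hoeffding's averaging over permutations (`integral_sup_uStatistic_le`) replaces the U-statistic by
  a mean over `n / 2` independent pairs.
* Symmetrization with a ghost sample (`integral_sup_sub_two_mul_average_le`): by the Bernstein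
  condition the factor `2` leaves a negative quadratic offset, which cancels the variance of the
  random signs in a moment generating function, so that the supremum is at most
  `log N / n` up to a constant, where `N` is the size of a cover of the class at the sample points.
* The Sauer-Shelah lemma, applied to the traces of subgraphs on a grid over the sample points
  (`exists_empirical_cover`), bounds `N` by a polynomial in `n`.

The `L²(O)` bound follows, as the density of `O` with respect to `P ⊗ Q` is at most `B`.
-/

/-! ### Empirical covers of Vapnik-Chervonenkis classes -/

/-- A form of the Sauer-Shelah lemma: a family that shatters only sets of at most `d` elements of `G`
has at most `(|G| + 1) ^ d` members. -/
theorem card_shatterer_le_pow {α : Type*} [DecidableEq α] (𝒜 : Finset (Finset α)) (G : Finset α)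
    (d : ℕ) (hG : ∀ s ∈ 𝒜.shatterer, s ⊆ G) (hd : ∀ s ∈ 𝒜.shatterer, s.card ≤ d) :
    𝒜.card ≤ (G.card + 1) ^ d := by
  have hsub : 𝒜.shatterer ⊆ (Finset.range (d + 1)).biUnion (fun k => G.powersetCard k) := by
    intro s hs
    simp only [Finset.mem_biUnion, Finset.mem_range, Finset.mem_powersetCard]
    exact ⟨s.card, Nat.lt_succ_of_le (hd s hs), hG s hs, rfl⟩
  calc 𝒜.card ≤ 𝒜.shatterer.card := Finset.card_le_card_shatterer 𝒜
    _ ≤ _ := Finset.card_le_card hsub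
    _ ≤ ∑ k ∈ Finset.range (d + 1), (G.powersetCard k).card := Finset.card_biUnion_le
    _ ≤ ∑ k ∈ Finset.range (d + 1), G.card ^ k * 1 ^ (d - k) * d.choose k := by
        refine Finset.sum_le_sum fun k hk => ?_
        rw [Finset.card_powersetCard, one_pow, mul_one]
        have h1 : 0 < d.choose k := Nat.choose_pos (Nat.lt_succ_iff.mp (Finset.mem_range.mp hk))
        exact (Nat.choose_le_pow _ _).trans (Nat.le_mul_of_pos_right _ h1)
    _ = (G.card + 1) ^ d := (add_pow _ _ _).symm

/-- A finite part of a bounded Vapnik-Chervonenkis class is covered, uniformly on a finite set `S` of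
points and up to `1 / K`, by polynomially many of its members: functions whose subgraphs have the
same trace on the grid `S × (ℤ / K)` are close on `S`, and Sauer-Shelah counts the traces. -/
theorem exists_empirical_cover {α : Type*} {R : Set (α → ℝ)} {d : ℕ}
    (hd : ∀ s : Finset (α × ℝ), d < s.card → ¬ ShattersSet (subgraph '' R) s) {B : ℝ}
    (hB : ∀ r ∈ R, ∀ q, |r q| ≤ B) (F : Finset R) (S : Finset α) {K : ℕ} (hK : 0 < K) :
    ∃ F₀ ⊆ F, F₀.card ≤ (S.card * (2 * ⌈B * K⌉₊ + 1) + 1) ^ d ∧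
      ∀ r ∈ F, ∃ r₀ ∈ F₀, ∀ x ∈ S, |r.1 x - r₀.1 x| ≤ 1 / (K : ℝ) := by
  classical
  have hK' : (0 : ℝ) < K := by exact_mod_cast hK
  set L : ℤ := (⌈B * K⌉₊ : ℤ) with hL
  set G : Finset (α × ℝ) :=
    S ×ˢ (Finset.Icc (-L) L).image (fun k : ℤ => (k : ℝ) / K) with hG
  have hGcard : G.card ≤ S.card * (2 * ⌈B * K⌉₊ + 1) := by
    rw [hG, Finset.card_product]
    refine Nat.mul_le_mul_left _ (Finset.card_image_le.trans ?_)
    rw [Int.card_Icc]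
    omega
  set tr : R → Finset (α × ℝ) := fun r => G.filter (fun a => a.2 < r.1 a.1) with htr
  -- Functions with the same trace on the grid are within one grid step of each other.
  have key : ∀ r r' : R, tr r = tr r' → ∀ x ∈ S, r'.1 x ≤ r.1 x + 1 / (K : ℝ) := by
    intro r r' h x hx
    by_contra! hlt
    set k : ℤ := ⌈r.1 x * K⌉ with hk
    have hk1 : r.1 x * K ≤ k := Int.le_ceil _
    have hk2 : (k : ℝ) < r.1 x * K + 1 := Int.ceil_lt_add_one _
    have hrx := abs_le.mp (hB r.1 r.2 x)
    have hkL : k ≤ L := by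
      rw [hk, Int.ceil_le, hL]
      push_cast
      exact (mul_le_mul_of_nonneg_right hrx.2 hK'.le).trans (Nat.le_ceil _)
    have hkL' : -L ≤ k := by
      have h1 : ((-L : ℤ) : ℝ) ≤ k := by
        rw [hL]
        push_cast
        have h2 := Nat.le_ceil (B * K)
        have h3 := mul_le_mul_of_nonneg_right hrx.1 hK'.le
        linarith
      exact_mod_cast h1
    have hmem : ((x, (k : ℝ) / K) : α × ℝ) ∈ G := by
      rw [hG, Finset.mem_product]
      exact ⟨hx, Finset.mem_image.mpr ⟨k, Finset.mem_Icc.mpr ⟨hkL', hkL⟩, rfl⟩⟩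
    have h1 : ((x, (k : ℝ) / K) : α × ℝ) ∈ tr r' := by
      refine Finset.mem_filter.mpr ⟨hmem, ?_⟩
      refine lt_of_le_of_lt ?_ hlt
      rw [div_le_iff₀ hK', add_mul, one_div, inv_mul_cancel₀ hK'.ne']
      exact hk2.le
    rw [← h] at h1
    have h2 : (k : ℝ) / K < r.1 x := (Finset.mem_filter.mp h1).2
    rw [div_lt_iff₀ hK'] at h2
    linarith
  obtain ⟨F₀, hF₀, hinj, himg⟩ := Finset.exists_subset_injOn_image_eq_of_surjOn (f := tr)
    (↑F : Set R) (F.image tr) (by intro y hy; simpa using hy)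
  refine ⟨F₀, by exact_mod_cast hF₀, ?_, ?_⟩
  · rw [← Finset.card_image_of_injOn hinj, himg]
    have hshat : ∀ s ∈ (F.image tr).shatterer, s ⊆ G := by
      intro s hs
      obtain ⟨t, ht, hst⟩ := (Finset.mem_shatterer.1 hs).exists_superset
      obtain ⟨r, -, rfl⟩ := Finset.mem_image.mp ht
      exact hst.trans (Finset.filter_subset _ _)
    refine (card_shatterer_le_pow _ G d hshat fun s hs => ?_).trans
      (Nat.pow_le_pow_left (Nat.succ_le_succ hGcard) d)
    by_contra! hlt
    refine hd s hlt fun t ht => ?_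
    obtain ⟨u, hu, hsu⟩ := Finset.mem_shatterer.1 hs (Finset.filter_subset (· ∈ t) s)
    obtain ⟨r, -, rfl⟩ := Finset.mem_image.mp hu
    refine ⟨subgraph r.1, ⟨r.1, r.2, rfl⟩, ?_⟩
    ext a
    have h1 := Finset.ext_iff.mp hsu a
    have h2 : a ∈ s → a ∈ G := fun h => hshat s hs h
    have h3 : a ∈ t → a ∈ s := fun h => ht h
    simp only [htr, Finset.mem_inter, Finset.mem_filter] at h1
    simp only [subgraph, Set.mem_inter_iff, Set.mem_ofPred_eq, Finset.mem_coe]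
    tauto
  · intro r hr
    have h1 : tr r ∈ F₀.image tr := himg ▸ Finset.mem_image_of_mem tr hr
    obtain ⟨r₀, hr₀, h⟩ := Finset.mem_image.mp h1
    refine ⟨r₀, hr₀, fun x hx => abs_le.mpr ⟨?_, ?_⟩⟩
    · linarith [key r r₀ h.symm x hx]
    · linarith [key r₀ r h x hx]

/-- The logarithm of a polynomially growing cover, divided by the sample size, is of order `n ^ (-a)`
for every `a < 1`. -/
theorem exists_log_cover_div_le_rpow (d : ℕ) {B a c₁ c₂ : ℝ} (hB : 0 ≤ B) (ha0 : 0 < a) (ha1 : a < 1)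
    (hc₁ : 0 ≤ c₁) (hc₂ : 0 ≤ c₂) : ∃ C : ℝ, 0 < C ∧ ∀ n : ℕ, 2 ≤ n →
      c₁ * Real.log (((4 * (n / 2) * (2 * ⌈B * (n / 2 : ℕ)⌉₊ + 1) + 1) ^ d : ℕ) : ℝ) / (n / 2 : ℕ)
        + c₂ * (1 / (n / 2 : ℕ)) ≤ C * (n : ℝ) ^ (-a) := by
  have hk : 0 < 1 - a := by linarith
  have hlog0 : 0 ≤ Real.log (8 * B + 13) := Real.log_nonneg (by linarith)
  set K : ℝ := c₁ * (d * (Real.log (8 * B + 13) + 2 / (1 - a))) + c₂ with hK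
  have hK0 : 0 ≤ K := by positivity
  refine ⟨3 * K + 1, by positivity, fun n hn => ?_⟩
  set m : ℕ := n / 2 with hm
  have hm1 : 1 ≤ m := by omega
  have hnm : n ≤ 3 * m := by omega
  have hx1 : (1 : ℝ) ≤ m := by exact_mod_cast hm1
  have hx0 : (0 : ℝ) < m := by linarith
  have hn3 : (n : ℝ) / 3 ≤ m := by
    have : (n : ℝ) ≤ 3 * m := by exact_mod_cast hnm
    linarith
  have hn0 : (0 : ℝ) < n := by
    have : 0 < n := by omega
    exact_mod_cast this
  have hxk : (1 : ℝ) ≤ (m : ℝ) ^ (1 - a) := Real.one_le_rpow hx1 hk.le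
  have hlogN : Real.log (((4 * m * (2 * ⌈B * m⌉₊ + 1) + 1) ^ d : ℕ) : ℝ) ≤
      d * (Real.log (8 * B + 13) + 2 / (1 - a)) * (m : ℝ) ^ (1 - a) := by
    have h1 : (((4 * m * (2 * ⌈B * m⌉₊ + 1) + 1 : ℕ)) : ℝ) ≤ (8 * B + 13) * (m : ℝ) ^ 2 := by
      have h2 : (⌈B * m⌉₊ : ℝ) ≤ B * m + 1 := (Nat.ceil_lt_add_one (by positivity)).le
      push_cast
      nlinarith
    rw [Nat.cast_pow, Real.log_pow, mul_assoc (d : ℝ)]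
    refine mul_le_mul_of_nonneg_left ?_ (Nat.cast_nonneg d)
    have h3 := Real.log_le_log (by positivity) h1
    rw [Real.log_mul (by positivity) (by positivity), Real.log_pow] at h3
    have h4 := Real.log_le_rpow_div hx0.le hk
    have h5 : Real.log (8 * B + 13) ≤ Real.log (8 * B + 13) * (m : ℝ) ^ (1 - a) :=
      le_mul_of_one_le_right hlog0 hxk
    have h6 : 2 / (1 - a) * (m : ℝ) ^ (1 - a) = 2 * ((m : ℝ) ^ (1 - a) / (1 - a)) := by ring
    rw [add_mul, h6]
    push_cast at h3 ⊢
    linarith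
  have hpow : (m : ℝ) ^ (1 - a) / m = (m : ℝ) ^ (-a) := by
    rw [div_eq_iff hx0.ne', ← Real.rpow_add_one hx0.ne']
    congr 1; ring
  have hma : (m : ℝ) ^ (-a) ≤ 3 * (n : ℝ) ^ (-a) := by
    have h1 : (m : ℝ) ^ (-a) ≤ ((n : ℝ) / 3) ^ (-a) :=
      Real.rpow_le_rpow_of_nonpos (by positivity) hn3 (by linarith)
    have h2 : ((n : ℝ) / 3) ^ (-a) = 3 ^ a * (n : ℝ) ^ (-a) := by
      rw [Real.div_rpow hn0.le (by norm_num), Real.rpow_neg (by norm_num : (0 : ℝ) ≤ 3)]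
      field_simp
    have h3 : (3 : ℝ) ^ a ≤ 3 := by
      simpa using Real.rpow_le_rpow_of_exponent_le (by norm_num : (1 : ℝ) ≤ 3) ha1.le
    rw [h2] at h1
    exact h1.trans (mul_le_mul_of_nonneg_right h3 (by positivity))
  calc _ ≤ c₁ * (d * (Real.log (8 * B + 13) + 2 / (1 - a)) * (m : ℝ) ^ (1 - a)) / m
        + c₂ * ((m : ℝ) ^ (1 - a) / m) := by
        gcongr
    _ = K * (m : ℝ) ^ (-a) := by rw [← hpow, hK]; ring
    _ ≤ K * (3 * (n : ℝ) ^ (-a)) := by gcongr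
    _ ≤ (3 * K + 1) * (n : ℝ) ^ (-a) := by nlinarith [Real.rpow_nonneg hn0.le (-a)]

/-! ### Symmetrization with a quadratic offset -/

/-- A maximal inequality for random signs, whose average is a sum over `Fin m → Bool`: if the offset
`b r` dominates the sub-Gaussian variance term at the level `l`, the expected maximum of `N` offset
signed sums is at most `log N / l`. The maximum enters through any `M` lying below it. -/
theorem average_le_log_card_div {ι : Type*} {m : ℕ} (F : Finset ι) (a : ι → Fin m → ℝ) (b : ι → ℝ)
    {l : ℝ} (hl : 0 < l) (hb : ∀ r ∈ F, l / 2 * ∑ i, a r i ^ 2 ≤ b r) (M : (Fin m → Bool) → ℝ)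
    (hM : ∀ s, ∃ r ∈ F, M s ≤ ∑ i, (if s i then a r i else -a r i) - b r) :
    (∑ s, M s) / 2 ^ m ≤ Real.log F.card / l := by
  have hFne : F.Nonempty := by
    obtain ⟨r, hr, -⟩ := hM (fun _ => true)
    exact ⟨r, hr⟩
  have hN : (0 : ℝ) < F.card := by exact_mod_cast hFne.card_pos
  have hmgf : ∀ r ∈ F,
      ∑ s : Fin m → Bool, Real.exp (l * (∑ i, (if s i then a r i else -a r i) - b r)) ≤ 2 ^ m := by
    intro r hr
    have h1 : ∀ s : Fin m → Bool,
        Real.exp (l * (∑ i, (if s i then a r i else -a r i) - b r)) =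
          Real.exp (-(l * b r)) * ∏ i, Real.exp (l * (if s i then a r i else -a r i)) := by
      intro s
      rw [← Real.exp_sum, ← Real.exp_add, ← Finset.mul_sum]
      congr 1; ring
    simp_rw [h1]
    rw [← Finset.mul_sum]
    have h2 : ∑ s : Fin m → Bool, ∏ i, Real.exp (l * (if s i then a r i else -a r i)) =
        ∏ i, (2 * Real.cosh (l * a r i)) := by
      have := Finset.prod_univ_sum (fun _ : Fin m => (Finset.univ : Finset Bool))
        (fun i s => Real.exp (l * (if s then a r i else -a r i)))
      rw [Fintype.piFinset_univ] at this
      rw [← this]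
      refine Finset.prod_congr rfl fun i _ => ?_
      rw [Fintype.sum_bool, Real.cosh_eq]
      simp
      ring
    rw [h2, Finset.prod_mul_distrib, Finset.prod_const, Finset.card_univ, Fintype.card_fin]
    have h3 : ∏ i, Real.cosh (l * a r i) ≤ Real.exp (l * b r) := by
      calc ∏ i, Real.cosh (l * a r i) ≤ ∏ i, Real.exp ((l * a r i) ^ 2 / 2) :=
            Finset.prod_le_prod (fun i _ => (Real.cosh_pos _).le)
              fun i _ => Real.cosh_le_exp_half_sq _
        _ = Real.exp (l * (l / 2 * ∑ i, a r i ^ 2)) := by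
            rw [← Real.exp_sum]
            congr 1
            rw [Finset.mul_sum, Finset.mul_sum]
            exact Finset.sum_congr rfl fun i _ => by ring
        _ ≤ _ := Real.exp_le_exp.mpr (mul_le_mul_of_nonneg_left (hb r hr) hl.le)
    calc Real.exp (-(l * b r)) * (2 ^ m * ∏ i, Real.cosh (l * a r i))
        ≤ Real.exp (-(l * b r)) * (2 ^ m * Real.exp (l * b r)) := by gcongr
      _ = 2 ^ m := by
        rw [mul_left_comm, ← Real.exp_add]; simp
  have hpt : ∀ s, l * M s ≤ Real.log F.card - 1 + (∑ r ∈ F,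
      Real.exp (l * (∑ i, (if s i then a r i else -a r i) - b r))) / F.card := by
    intro s
    obtain ⟨r, hr, hMr⟩ := hM s
    have h1 := Real.add_one_le_exp (l * M s - Real.log F.card)
    rw [Real.exp_sub, Real.exp_log hN] at h1
    have h2 : Real.exp (l * M s) ≤ ∑ r ∈ F,
        Real.exp (l * (∑ i, (if s i then a r i else -a r i) - b r)) :=
      (Real.exp_le_exp.mpr (mul_le_mul_of_nonneg_left hMr hl.le)).trans
        (Finset.single_le_sum (f := fun r =>
          Real.exp (l * (∑ i, (if s i then a r i else -a r i) - b r)))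
          (fun _ _ => (Real.exp_pos _).le) hr)
    have h3 := div_le_div_of_nonneg_right h2 hN.le
    linarith
  have hsum := Finset.sum_le_sum fun s (_ : s ∈ (Finset.univ : Finset (Fin m → Bool))) => hpt s
  rw [← Finset.mul_sum, Finset.sum_add_distrib, Finset.sum_const, ← Finset.sum_div,
    Finset.sum_comm] at hsum
  have h4 := div_le_div_of_nonneg_right (Finset.sum_le_sum hmgf) hN.le
  rw [Finset.sum_const, nsmul_eq_mul, mul_div_assoc, mul_div_cancel₀ _ hN.ne'] at h4
  have hcard : ((Finset.univ : Finset (Fin m → Bool)).card : ℝ) = 2 ^ m := by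
    simp
  rw [nsmul_eq_mul, hcard] at hsum
  rw [div_le_div_iff₀ (by positivity) hl]
  nlinarith

theorem abs_sup'_le {ι : Type*} {F : Finset ι} (hF : F.Nonempty) {f : ι → ℝ} {C : ℝ}
    (h : ∀ r ∈ F, |f r| ≤ C) : |F.sup' hF f| ≤ C := by
  obtain ⟨r, hr, he⟩ := Finset.exists_mem_eq_sup' hF f
  rw [he]
  exact h r hr

theorem measurable_finset_sup' {ι T : Type*} [MeasurableSpace T] {F : Finset ι} (hF : F.Nonempty)
    {f : ι → T → ℝ} (hf : ∀ r, Measurable (f r)) :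
    Measurable (fun t => F.sup' hF (fun r => f r t)) := by
  have h := Finset.measurable_sup' hF (f := f) (fun r _ => hf r)
  convert h using 1
  ext t
  rw [Finset.sup'_apply]

theorem integrable_finset_sup' {ι T : Type*} [MeasurableSpace T] (ρ : Measure T)
    [IsProbabilityMeasure ρ] {F : Finset ι} (hF : F.Nonempty) {f : ι → T → ℝ}
    (hf : ∀ r, Measurable (f r)) {C : ℝ} (h : ∀ r t, |f r t| ≤ C) :
    Integrable (fun t => F.sup' hF (fun r => f r t)) ρ :=
  Integrable.of_bound (measurable_finset_sup' hF hf).aestronglyMeasurable C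
    (ae_of_all _ fun t => abs_sup'_le hF fun r _ => h r t)

theorem measurePreserving_swap_of_signs {T : Type*} [MeasurableSpace T] (τ : Measure T)
    [IsProbabilityMeasure τ] {m : ℕ} (s : Fin m → Bool) :
    MeasurePreserving (fun (u : Fin m → T × T) i => if s i then u i else (u i).swap)
      (Measure.pi fun _ : Fin m => τ.prod τ) (Measure.pi fun _ : Fin m => τ.prod τ) := by
  refine measurePreserving_pi (f := fun i (x : T × T) => if s i then x else x.swap) _ _ fun i => ?_
  cases s i
  · simpa using! Measure.measurePreserving_swap
  · simpa using! MeasurePreserving.id _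

/-- Summand of the symmetrized offset process: twice the increment of `g` from the sample point
`x.1` to its ghost `x.2`, minus a quadratic offset. -/
noncomputable def offsetSummand {T : Type*} (c : ℝ) (g : T → ℝ) (x : T × T) : ℝ :=
  2 * (g x.2 - g x.1) - g x.2 ^ 2 / c

theorem measurable_offsetSummand {T : Type*} [MeasurableSpace T] {c : ℝ} {g : T → ℝ}
    (hg : Measurable g) : Measurable (offsetSummand c g) := by
  unfold offsetSummand
  fun_prop

theorem abs_offsetSummand_le {T : Type*} {b c : ℝ} (hc : 0 < c) {g : T → ℝ} (hb : ∀ x, |g x| ≤ b)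
    (x : T × T) : |offsetSummand c g x| ≤ 4 * b + b ^ 2 / c := by
  have h1 := abs_le.mp (hb x.1)
  have h2 := abs_le.mp (hb x.2)
  have h3 : g x.2 ^ 2 / c ≤ b ^ 2 / c := div_le_div_of_nonneg_right (sq_le_sq' h2.1 h2.2) hc.le
  have h4 : 0 ≤ g x.2 ^ 2 / c := by positivity
  have h5 : 0 ≤ b ^ 2 / c := by positivity
  unfold offsetSummand
  exact abs_le.mpr ⟨by linarith, by linarith⟩

theorem abs_offsetSummand_sub_le {T : Type*} {b c η : ℝ} (hc : 0 < c) {g g' : T → ℝ}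
    (hb : ∀ x, |g x| ≤ b) (hb' : ∀ x, |g' x| ≤ b) {x : T × T}
    (h1 : |g x.1 - g' x.1| ≤ η) (h2 : |g x.2 - g' x.2| ≤ η) :
    |offsetSummand c g x - offsetSummand c g' x| ≤ (4 + 2 * b / c) * η := by
  have h3 : |g x.2 ^ 2 / c - g' x.2 ^ 2 / c| ≤ 2 * b / c * η := by
    rw [← sub_div, sq_sub_sq, abs_div, abs_mul, abs_of_pos hc, div_mul_eq_mul_div]
    refine div_le_div_of_nonneg_right ?_ hc.le
    refine mul_le_mul ?_ h2 (abs_nonneg _) ?_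
    · exact (abs_add_le _ _).trans (by linarith [hb x.2, hb' x.2])
    · linarith [hb x.2, abs_nonneg (g x.2)]
  unfold offsetSummand
  rw [abs_le] at *
  constructor <;> linarith

/-- The antisymmetric part of `offsetSummand`, squared, is dominated by its symmetric part, the
offset that remains after the exchange of a sample point and its ghost. -/
theorem sq_antisymmetric_part_le {b c y z : ℝ} (hc : 0 < c) (hy : |y| ≤ b) (hz : |z| ≤ b) :
    1 / (2 * c * (2 + b / c) ^ 2) / 2 * (2 * (z - y) + (y ^ 2 - z ^ 2) / (2 * c)) ^ 2
      ≤ (y ^ 2 + z ^ 2) / (2 * c) := by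
  have hb : 0 ≤ b := (abs_nonneg y).trans hy
  rw [abs_le] at hy hz
  have h0 : 0 < 2 + b / c := by positivity
  have h1 : (2 * (z - y) + (y ^ 2 - z ^ 2) / (2 * c)) ^ 2 =
      (z - y) ^ 2 * (2 - (y + z) / (2 * c)) ^ 2 := by
    field_simp
    ring
  have h2 : (2 - (y + z) / (2 * c)) ^ 2 ≤ (2 + b / c) ^ 2 := by
    have h3 : (y + z) / (2 * c) ≤ b / c := by
      rw [div_le_div_iff₀ (by positivity) hc]
      nlinarith
    have h4 : -(b / c) ≤ (y + z) / (2 * c) := by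
      rw [← neg_div, div_le_div_iff₀ hc (by positivity)]
      nlinarith
    exact sq_le_sq' (by linarith) (by linarith)
  have h5 : (z - y) ^ 2 ≤ 2 * (y ^ 2 + z ^ 2) := by nlinarith [sq_nonneg (z + y)]
  calc _ ≤ 1 / (2 * c * (2 + b / c) ^ 2) / 2 * (2 * (y ^ 2 + z ^ 2) * (2 + b / c) ^ 2) := by
        rw [h1]
        gcongr
    _ = (y ^ 2 + z ^ 2) / (2 * c) := by
        field_simp

theorem integral_comp_measurePreserving {S T : Type*} [MeasurableSpace S] [MeasurableSpace T]
    {ρ : Measure S} {τ : Measure T} {f : S → T} (hf : MeasurePreserving f ρ τ) {g : T → ℝ}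
    (hg : Measurable g) : ∫ x, g (f x) ∂ρ = ∫ y, g y ∂τ := by
  rw [← hf.map_eq, integral_map hf.measurable.aemeasurable hg.aestronglyMeasurable]

/-- Symmetrization with a ghost sample. The Bernstein condition `∫ g² ≤ c ∫ g` pays for the
quadratic offset that, conditionally on the sample and its ghost, absorbs the variance of the random
signs; hence a finite cover alone gives the fast rate. -/
theorem integral_sup_sub_two_mul_average_le {T ι : Type*} [MeasurableSpace T] (τ : Measure T)
    [IsProbabilityMeasure τ] {F : Finset ι} (hF : F.Nonempty) {g : ι → T → ℝ}
    (hg : ∀ r, Measurable (g r)) {b c η : ℝ} (hc : 0 < c) (hb0 : 0 ≤ b) (hb : ∀ r x, |g r x| ≤ b)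
    (hvar : ∀ r, ∫ x, g r x ^ 2 ∂τ ≤ c * ∫ x, g r x ∂τ) {m : ℕ} (hm : 0 < m) {N : ℕ}
    (hcov : ∀ u : Fin m → T × T, ∃ F₀ ⊆ F, F₀.card ≤ N ∧ ∀ r ∈ F, ∃ r₀ ∈ F₀, ∀ i,
      |g r (u i).1 - g r₀ (u i).1| ≤ η ∧ |g r (u i).2 - g r₀ (u i).2| ≤ η) :
    ∫ t, F.sup' hF (fun r => ∫ x, g r x ∂τ - 2 * ((∑ i, g r (t i)) / m))
        ∂(Measure.pi fun _ : Fin m => τ) ≤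
      2 * c * (2 + b / c) ^ 2 * Real.log N / m + (4 + 2 * b / c) * η := by
  have hm' : (0 : ℝ) < m := by exact_mod_cast hm
  have hint : ∀ r, Integrable (g r) τ := fun r =>
    Integrable.of_bound (hg r).aestronglyMeasurable b (ae_of_all _ (hb r))
  have hint2 : ∀ r, Integrable (fun x => g r x ^ 2) τ := fun r =>
    Integrable.of_bound ((hg r).pow_const 2).aestronglyMeasurable (b ^ 2) (ae_of_all _ fun x => by
      rw [Real.norm_eq_abs, abs_pow]
      exact pow_le_pow_left₀ (abs_nonneg _) (hb r x) 2)
  set Ψ : ι → (Fin m → T × T) → ℝ := fun r u => (∑ i, offsetSummand c (g r) (u i)) / m with hΨ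
  have hΨm : ∀ r, Measurable (Ψ r) := fun r => by
    refine Measurable.div_const (Finset.measurable_sum _ fun i _ => ?_) _
    exact (measurable_offsetSummand (hg r)).comp (measurable_pi_apply i)
  have hΨb : ∀ r u, |Ψ r u| ≤ 4 * b + b ^ 2 / c := by
    intro r u
    rw [hΨ]
    simp only
    rw [abs_div, abs_of_pos hm', div_le_iff₀ hm']
    refine (Finset.abs_sum_le_sum_abs _ _).trans ?_
    refine (Finset.sum_le_sum fun i _ => abs_offsetSummand_le hc (hb r) (u i)).trans (le_of_eq ?_)
    rw [Finset.sum_const, Finset.card_univ, Fintype.card_fin, nsmul_eq_mul, mul_comm]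
  set S : (Fin m → T × T) → ℝ := fun u => F.sup' hF (fun r => Ψ r u) with hS
  have hSint : Integrable S (Measure.pi fun _ : Fin m => τ.prod τ) :=
    integrable_finset_sup' _ hF hΨm hΨb
  -- Jensen: the expectation over the ghost sample is moved outside the supremum.
  have step1 : ∫ t, F.sup' hF (fun r => ∫ x, g r x ∂τ - 2 * ((∑ i, g r (t i)) / m))
        ∂(Measure.pi fun _ : Fin m => τ) ≤ ∫ u, S u ∂(Measure.pi fun _ : Fin m => τ.prod τ) := by
    have hmp := (measurePreserving_arrowProdEquivProdArrow T T (Fin m) (fun _ => τ)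
      (fun _ => τ)).symm
    rw [← hmp.integral_comp' S]
    have hSint' : Integrable
        (fun x => S ((MeasurableEquiv.arrowProdEquivProdArrow T T (Fin m)).symm x))
        ((Measure.pi fun _ : Fin m => τ).prod (Measure.pi fun _ : Fin m => τ)) :=
      hmp.integrable_comp_of_integrable hSint
    rw [integral_prod _ hSint']
    refine integral_mono ?_ hSint'.integral_prod_left ?_
    · refine integrable_finset_sup' _ hF (C := 3 * b) (fun r => ?_) fun r t => ?_
      · refine measurable_const.sub (measurable_const.mul (Measurable.div_const ?_ _))
        exact Finset.measurable_sum _ fun i _ => (hg r).comp (measurable_pi_apply i)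
      · have h1 : |∫ x, g r x ∂τ| ≤ b := by
          simpa using norm_integral_le_of_norm_le_const (μ := τ) (f := g r) (ae_of_all _ (hb r))
        have h2 : |(∑ i, g r (t i)) / m| ≤ b := by
          rw [abs_div, abs_of_pos hm', div_le_iff₀ hm']
          refine (Finset.abs_sum_le_sum_abs _ _).trans ?_
          refine (Finset.sum_le_sum fun i _ => hb r (t i)).trans ?_
          simp [mul_comm]
        rw [abs_le] at *
        constructor <;> linarith
    · intro t
      refine Finset.sup'_le hF _ fun r hr => ?_
      have hΨt : Integrable (fun t' : Fin m → T => Ψ r fun i => (t i, t' i))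
          (Measure.pi fun _ : Fin m => τ) := by
        refine Integrable.of_bound ((hΨm r).comp ?_).aestronglyMeasurable _
          (ae_of_all _ fun t' => hΨb r _)
        fun_prop
      have hval : ∫ t' : Fin m → T, Ψ r (fun i => (t i, t' i)) ∂(Measure.pi fun _ : Fin m => τ) =
          2 * ∫ x, g r x ∂τ - 2 * ((∑ i, g r (t i)) / m) - (∫ x, g r x ^ 2 ∂τ) / c := by
        have h1 : ∀ i : Fin m, ∫ t' : Fin m → T, offsetSummand c (g r) (t i, t' i)
            ∂(Measure.pi fun _ : Fin m => τ) =
            2 * ∫ x, g r x ∂τ - 2 * g r (t i) - (∫ x, g r x ^ 2 ∂τ) / c := by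
          intro i
          rw [integral_comp_measurePreserving (measurePreserving_eval (fun _ : Fin m => τ) i)
            (g := fun y => offsetSummand c (g r) (t i, y))
            ((measurable_offsetSummand (hg r)).comp measurable_prodMk_left)]
          simp only [offsetSummand]
          rw [integral_sub, integral_const_mul, integral_sub (hint r) (integrable_const _),
            integral_div]
          · simp
            ring
          · exact ((hint r).sub (integrable_const _)).const_mul 2
          · exact (hint2 r).div_const c
        simp only [hΨ]
        rw [integral_div, integral_finsetSum]
        · simp_rw [h1]
          rw [Finset.sum_sub_distrib, Finset.sum_sub_distrib, Finset.sum_const, Finset.sum_const,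
            ← Finset.mul_sum]
          simp
          field_simp
        · intro i _
          refine Integrable.of_bound (Measurable.aestronglyMeasurable ?_) _
            (ae_of_all _ fun t' => abs_offsetSummand_le hc (hb r) _)
          have := measurable_offsetSummand (c := c) (hg r)
          fun_prop
      have hle : ∫ x, g r x ∂τ - 2 * ((∑ i, g r (t i)) / m) ≤
          ∫ t' : Fin m → T, Ψ r (fun i => (t i, t' i)) ∂(Measure.pi fun _ : Fin m => τ) := by
        rw [hval]
        have := (div_le_iff₀' hc).mpr (hvar r)
        linarith
      refine hle.trans (integral_mono hΨt ?_ fun t' => ?_)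
      · exact integrable_finset_sup' _ hF (fun r => (hΨm r).comp (by fun_prop))
          fun r t' => hΨb r _
      · exact Finset.le_sup' (fun r => Ψ r fun i => (t i, t' i)) hr
  -- Exchanging sample and ghost coordinatewise does not change the law.
  have step2 : ∫ u, S u ∂(Measure.pi fun _ : Fin m => τ.prod τ) =
      ∫ u, (∑ s : Fin m → Bool, S (fun i => if s i then u i else (u i).swap)) / 2 ^ m
        ∂(Measure.pi fun _ : Fin m => τ.prod τ) := by
    have hmp := fun s : Fin m → Bool => measurePreserving_swap_of_signs τ s
    have hSm : Measurable S := measurable_finset_sup' hF hΨm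
    have hi : ∀ s : Fin m → Bool, Integrable (fun u => S (fun i => if s i then u i else (u i).swap))
        (Measure.pi fun _ : Fin m => τ.prod τ) := fun s =>
      (hmp s).integrable_comp_of_integrable hSint
    rw [integral_div, integral_finsetSum _ fun s _ => hi s]
    simp_rw [integral_comp_measurePreserving (hmp _) hSm]
    rw [Finset.sum_const, nsmul_eq_mul]
    simp
  rw [step2] at step1
  refine step1.trans ?_
  have hconst : ∀ C : ℝ, ∫ _, C ∂(Measure.pi fun _ : Fin m => τ.prod τ) = C := fun C => by simp
  rw [← hconst (_ + _)]
  refine integral_mono ?_ (integrable_const _) fun u => ?_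
  · exact (integrable_finsetSum _ fun s _ =>
      (measurePreserving_swap_of_signs τ s).integrable_comp_of_integrable hSint).div_const _
  set κ : ℝ := 4 + 2 * b / c with hκ
  set l : ℝ := 1 / (2 * c * (2 + b / c) ^ 2) with hl
  have hl0 : 0 < l := by positivity
  obtain ⟨F₀, hF₀, hcard, hF₀cov⟩ := hcov u
  have hF₀ne : F₀.Nonempty := by
    obtain ⟨r, hr⟩ := hF
    obtain ⟨r₀, hr₀, -⟩ := hF₀cov r hr
    exact ⟨r₀, hr₀⟩
  have hrad := average_le_log_card_div F₀
    (fun r i => 2 * (g r (u i).2 - g r (u i).1) + (g r (u i).1 ^ 2 - g r (u i).2 ^ 2) / (2 * c))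
    (fun r => ∑ i, (g r (u i).1 ^ 2 + g r (u i).2 ^ 2) / (2 * c)) hl0
    (fun r _ => by
      rw [Finset.mul_sum]
      exact Finset.sum_le_sum fun i _ => sq_antisymmetric_part_le hc (hb r _) (hb r _))
    (fun s => m * (S (fun i => if s i then u i else (u i).swap) - κ * η))
    (fun s => by
      obtain ⟨r, hr, he⟩ := Finset.exists_mem_eq_sup' hF
        (fun r => Ψ r (fun i => if s i then u i else (u i).swap))
      obtain ⟨r₀, hr₀, hclose⟩ := hF₀cov r hr
      refine ⟨r₀, hr₀, ?_⟩
      have he' : S (fun i => if s i then u i else (u i).swap) =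
          (∑ i, offsetSummand c (g r) (if s i then u i else (u i).swap)) / m := he
      simp only [he']
      rw [mul_sub, mul_div_cancel₀ _ hm'.ne', ← Finset.sum_sub_distrib, sub_le_iff_le_add]
      have hsum : ∑ _i : Fin m, κ * η = m * (κ * η) := by simp
      rw [← hsum, ← Finset.sum_add_distrib]
      refine Finset.sum_le_sum fun i _ => ?_
      have h1 := hclose i
      cases s i
      · have h2 := (abs_le.mp (abs_offsetSummand_sub_le (x := (u i).swap) hc (hb r) (hb r₀)
          h1.2 h1.1)).2
        have h3 : offsetSummand c (g r₀) (u i).swap =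
            -(2 * (g r₀ (u i).2 - g r₀ (u i).1)
              + (g r₀ (u i).1 ^ 2 - g r₀ (u i).2 ^ 2) / (2 * c))
              - (g r₀ (u i).1 ^ 2 + g r₀ (u i).2 ^ 2) / (2 * c) := by
          unfold offsetSummand
          simp only [Prod.fst_swap, Prod.snd_swap]
          field_simp
          ring
        simp only [Bool.false_eq_true, if_false]
        linarith
      · have h2 := (abs_le.mp (abs_offsetSummand_sub_le (x := u i) hc (hb r) (hb r₀)
          h1.1 h1.2)).2
        have h3 : offsetSummand c (g r₀) (u i) =
            (2 * (g r₀ (u i).2 - g r₀ (u i).1)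
              + (g r₀ (u i).1 ^ 2 - g r₀ (u i).2 ^ 2) / (2 * c))
              - (g r₀ (u i).1 ^ 2 + g r₀ (u i).2 ^ 2) / (2 * c) := by
          unfold offsetSummand
          field_simp
          ring
        simp only [if_true]
        linarith)
  rw [← Finset.mul_sum, Finset.sum_sub_distrib, Finset.sum_const] at hrad
  have hcard2 : ((Finset.univ : Finset (Fin m → Bool)).card : ℝ) = 2 ^ m := by simp
  rw [nsmul_eq_mul, hcard2, mul_div_assoc, sub_div, mul_div_cancel_left₀ _ (by positivity)] at hrad
  have hlog : Real.log F₀.card ≤ Real.log N :=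
    Real.log_le_log (by exact_mod_cast hF₀ne.card_pos) (by exact_mod_cast hcard)
  have h6 : Real.log F₀.card / l ≤ 2 * c * (2 + b / c) ^ 2 * Real.log N := by
    rw [hl, div_div_eq_mul_div, div_one, mul_comm]
    gcongr
  have h7 := (le_div_iff₀' hm').mpr (hrad.trans h6)
  simp only
  linarith

/-! ### U-statistics and averaging over permutations -/

/-- The U-statistic of order two with kernel `g` of the sample `V`, the average of `g` over ordered
pairs of distinct sample points. It is `0` for `n < 2`, where there are no such pairs. -/
noncomputable def uStatistic {T : Type*} {n : ℕ} (V : Fin n → T) (g : T × T → ℝ) : ℝ :=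
  (∑ p ∈ (Finset.univ : Finset (Fin n)).offDiag, g (V p.1, V p.2)) / (n * (n - 1))

theorem abs_uStatistic_le {T : Type*} {n : ℕ} (hn : 2 ≤ n) (v : Fin n → T) {g : T × T → ℝ} {C : ℝ}
    (hg : ∀ x, |g x| ≤ C) : |uStatistic v g| ≤ C := by
  have hn' : (2 : ℝ) ≤ n := by exact_mod_cast hn
  have hpos : (0 : ℝ) < n * (n - 1) := by nlinarith
  unfold uStatistic
  rw [abs_div, abs_of_pos hpos, div_le_iff₀ hpos]
  refine (Finset.abs_sum_le_sum_abs _ _).trans ((Finset.sum_le_sum fun p _ => hg _).trans ?_)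
  rw [Finset.sum_const, nsmul_eq_mul, Finset.offDiag_card, Nat.cast_sub (Nat.le_mul_self _)]
  simp
  linarith

theorem uStatistic_sub {T : Type*} {n : ℕ} (v : Fin n → T) (g g' : T × T → ℝ) :
    uStatistic v (fun x => g x - g' x) = uStatistic v g - uStatistic v g' := by
  unfold uStatistic
  rw [Finset.sum_sub_distrib, sub_div]

theorem exists_perm_apply_eq {α : Type*} [DecidableEq α] {a b x y : α} (hab : a ≠ b) (hxy : x ≠ y) :
    ∃ π : Equiv.Perm α, π a = x ∧ π b = y := by
  refine ⟨Equiv.swap (Equiv.swap a x b) y * Equiv.swap a x, ?_, ?_⟩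
  · rw [Equiv.Perm.mul_apply, Equiv.swap_apply_left]
    refine Equiv.swap_apply_of_ne_of_ne (fun h => hab ?_) hxy
    have := congrArg (Equiv.swap a x) h
    simpa using this
  · rw [Equiv.Perm.mul_apply, Equiv.swap_apply_left]

/-- The sum over permutations does not depend on the pair `a ≠ b`, so it can be computed by averaging
over all pairs. -/
theorem sum_perm_apply_pair {n : ℕ} {a b : Fin n} (hab : a ≠ b) (φ : Fin n × Fin n → ℝ) :
    (n * (n - 1) : ℝ) * ∑ σ : Equiv.Perm (Fin n), φ (σ a, σ b) =
      n.factorial * ∑ p ∈ (Finset.univ : Finset (Fin n)).offDiag, φ p := by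
  have h1 : ∀ p ∈ (Finset.univ : Finset (Fin n)).offDiag,
      ∑ σ : Equiv.Perm (Fin n), φ (σ p.1, σ p.2) = ∑ σ : Equiv.Perm (Fin n), φ (σ a, σ b) := by
    intro p hp
    obtain ⟨π, h, h'⟩ := exists_perm_apply_eq hab (Finset.mem_offDiag.mp hp).2.2
    rw [← h, ← h']
    exact Equiv.sum_comp (Equiv.mulRight π) (fun σ => φ (σ a, σ b))
  have h2 : ∀ σ : Equiv.Perm (Fin n),
      ∑ p ∈ (Finset.univ : Finset (Fin n)).offDiag, φ (σ p.1, σ p.2) =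
        ∑ p ∈ (Finset.univ : Finset (Fin n)).offDiag, φ p := by
    intro σ
    refine Finset.sum_equiv (σ.prodCongr σ) (fun p => ?_) fun p _ => rfl
    simp [Finset.mem_offDiag]
  have h3 := Finset.sum_congr rfl h1
  rw [Finset.sum_comm, Finset.sum_congr rfl fun σ _ => h2 σ, Finset.sum_const, Finset.sum_const,
    Finset.offDiag_card] at h3
  simp only [Finset.card_univ, Fintype.card_perm, Fintype.card_fin, nsmul_eq_mul] at h3
  rw [h3, Nat.cast_sub (Nat.le_mul_self n)]
  push_cast
  ring

theorem uStatistic_eq_average_perm {T : Type*} {n m : ℕ} (hm : 0 < m) {e : Fin m ⊕ Fin m → Fin n}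
    (he : Function.Injective e) (V : Fin n → T) (g : T × T → ℝ) :
    uStatistic V g = (∑ σ : Equiv.Perm (Fin n),
      (∑ k, g (V (σ (e (.inl k))), V (σ (e (.inr k))))) / m) / n.factorial := by
  have hm' : (0 : ℝ) < m := by exact_mod_cast hm
  have hne : ∀ k, e (.inl k) ≠ e (.inr k) := fun k h => by simpa using he h
  have hn : 1 < n := by
    by_contra! h
    have := Fin.subsingleton_iff_le_one.mpr h
    exact hne ⟨0, hm⟩ (Subsingleton.elim _ _)
  have hn' : (1 : ℝ) < n := by exact_mod_cast hn
  have h1 : ∀ k, ∑ σ : Equiv.Perm (Fin n), g (V (σ (e (.inl k))), V (σ (e (.inr k)))) =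
      n.factorial * uStatistic V g := by
    intro k
    have := sum_perm_apply_pair (hne k) (fun p => g (V p.1, V p.2))
    have h0 : (n * (n - 1) : ℝ) ≠ 0 := by
      have : (n : ℝ) - 1 ≠ 0 := by linarith
      positivity
    rw [uStatistic, ← mul_div_assoc, eq_div_iff h0, ← this]
    ring
  rw [← Finset.sum_div, Finset.sum_comm, Finset.sum_congr rfl fun k _ => h1 k, Finset.sum_const]
  have : (n.factorial : ℝ) ≠ 0 := by positivity
  simp
  field_simp

theorem measurePreserving_disjoint_pairs {Ω T : Type*} [MeasurableSpace Ω] [MeasurableSpace T]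
    {ρ : Measure Ω} [IsProbabilityMeasure ρ] {τ : Measure T} [IsProbabilityMeasure τ] {ι : Type*}
    {V : ι → Ω → T} (hV : ∀ i, Measurable (V i)) (hindep : iIndepFun V ρ)
    (hlaw : ∀ i, ρ.map (V i) = τ) {m : ℕ} {e : Fin m ⊕ Fin m → ι} (he : Function.Injective e) :
    MeasurePreserving (fun ω k => (V (e (.inl k)) ω, V (e (.inr k)) ω)) ρ
      (Measure.pi fun _ : Fin m => τ.prod τ) := by
  have h1 := (iIndepFun_iff_map_fun_eq_pi_map (fun k => (hV (e k)).aemeasurable)).mp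
    (hindep.precomp he)
  have h2 : MeasurePreserving (fun ω k => V (e k) ω) ρ
      (Measure.pi fun _ : Fin m ⊕ Fin m => τ) := by
    refine ⟨by fun_prop, ?_⟩
    simpa [hlaw] using h1
  have h3 := (measurePreserving_arrowProdEquivProdArrow T T (Fin m) (fun _ => τ)
      (fun _ => τ)).symm
  exact (h3.comp (measurePreserving_sumPiEquivProdPi fun _ : Fin m ⊕ Fin m => τ)).comp h2

/-- Hoeffding's averaging device: a U-statistic is an average, over permutations of the sample, of
means over disjoint pairs of sample points, so that expected suprema of the former are bounded by
those of means of independent variables. -/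
theorem integral_sup_uStatistic_le {Ω T ι : Type*} [MeasurableSpace Ω] [MeasurableSpace T]
    {ρ : Measure Ω} [IsProbabilityMeasure ρ] {τ : Measure T} [IsProbabilityMeasure τ] {n : ℕ}
    {V : Fin n → Ω → T} (hV : ∀ i, Measurable (V i)) (hindep : iIndepFun V ρ)
    (hlaw : ∀ i, ρ.map (V i) = τ) {F : Finset ι} (hF : F.Nonempty) {g : ι → T × T → ℝ}
    (hg : ∀ r, Measurable (g r)) {b : ℝ} (hb : ∀ r x, |g r x| ≤ b) {E : ι → ℝ}
    (hE : ∀ r, |E r| ≤ b) {m : ℕ} (hm : 0 < m) (hmn : 2 * m ≤ n) {C : ℝ}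
    (hC : ∫ t, F.sup' hF (fun r => E r - 2 * ((∑ i, g r (t i)) / m))
        ∂(Measure.pi fun _ : Fin m => τ.prod τ) ≤ C) :
    ∫ ω, F.sup' hF (fun r => E r - 2 * uStatistic (fun i => V i ω) (g r)) ∂ρ ≤ C := by
  have hm' : (0 : ℝ) < m := by exact_mod_cast hm
  obtain ⟨e, he⟩ : ∃ e : Fin m ⊕ Fin m → Fin n, Function.Injective e :=
    ⟨fun k => Fin.castLE (by omega) (finSumFinEquiv k), fun x y h =>
      finSumFinEquiv.injective (Fin.castLE_injective _ h)⟩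
  set Φ : ι → (Fin m → T × T) → ℝ := fun r t => E r - 2 * ((∑ i, g r (t i)) / m) with hΦ
  have hΦm : ∀ r, Measurable (Φ r) := fun r => by
    refine measurable_const.sub (measurable_const.mul (Measurable.div_const ?_ _))
    exact Finset.measurable_sum _ fun i _ => (hg r).comp (measurable_pi_apply i)
  have hΦb : ∀ r t, |Φ r t| ≤ 3 * b := fun r t => by
    have h1 := hE r
    have h2 : |(∑ i, g r (t i)) / m| ≤ b := by
      rw [abs_div, abs_of_pos hm', div_le_iff₀ hm']
      refine (Finset.abs_sum_le_sum_abs _ _).trans ?_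
      refine (Finset.sum_le_sum fun i _ => hb r (t i)).trans ?_
      simp [mul_comm]
    rw [hΦ]
    rw [abs_le] at *
    constructor <;> linarith
  set S : (Fin m → T × T) → ℝ := fun t => F.sup' hF (fun r => Φ r t) with hS
  have hSm : Measurable S := measurable_finset_sup' hF hΦm
  have hSint : Integrable S (Measure.pi fun _ : Fin m => τ.prod τ) :=
    integrable_finset_sup' _ hF hΦm hΦb
  set pairs : Equiv.Perm (Fin n) → Ω → Fin m → T × T := fun σ ω k =>
    (V (σ (e (.inl k))) ω, V (σ (e (.inr k))) ω) with hpairs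
  have hmp : ∀ σ, MeasurePreserving (pairs σ) ρ (Measure.pi fun _ : Fin m => τ.prod τ) := fun σ =>
    measurePreserving_disjoint_pairs (e := fun k => σ (e k)) hV hindep hlaw (σ.injective.comp he)
  have hi : ∀ σ, Integrable (fun ω => S (pairs σ ω)) ρ := fun σ =>
    (hmp σ).integrable_comp_of_integrable hSint
  have hfac : (0 : ℝ) < n.factorial := by positivity
  have hval : ∀ r ω, E r - 2 * uStatistic (fun i => V i ω) (g r) =
      (∑ σ, Φ r (pairs σ ω)) / n.factorial := by
    intro r ω
    rw [uStatistic_eq_average_perm hm he]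
    simp only [hΦ, hpairs]
    rw [Finset.sum_sub_distrib, ← Finset.mul_sum, Finset.sum_const]
    simp only [Finset.card_univ, Fintype.card_perm, Fintype.card_fin, nsmul_eq_mul]
    field_simp
  have hpt : ∀ ω, F.sup' hF (fun r => E r - 2 * uStatistic (fun i => V i ω) (g r)) ≤
      (∑ σ, S (pairs σ ω)) / n.factorial := by
    intro ω
    refine Finset.sup'_le hF _ fun r hr => ?_
    rw [hval]
    refine div_le_div_of_nonneg_right (Finset.sum_le_sum fun σ _ => ?_) hfac.le
    exact Finset.le_sup' (fun r => Φ r (pairs σ ω)) hr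
  calc _ ≤ ∫ ω, (∑ σ, S (pairs σ ω)) / n.factorial ∂ρ := by
        refine integral_mono ?_ ((integrable_finsetSum _ fun σ _ => hi σ).div_const _) hpt
        simp_rw [hval]
        refine integrable_finset_sup' ρ hF (C := 3 * b) (fun r => ?_) fun r ω => ?_
        · exact (Finset.measurable_sum _ fun σ _ => (hΦm r).comp (hmp σ).measurable).div_const _
        · rw [abs_div, abs_of_pos hfac, div_le_iff₀ hfac]
          refine (Finset.abs_sum_le_sum_abs _ _).trans ?_
          refine (Finset.sum_le_sum fun σ _ => hΦb r (pairs σ ω)).trans (le_of_eq ?_)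
          simp only [Finset.sum_const, Finset.card_univ, Fintype.card_perm, Fintype.card_fin,
            nsmul_eq_mul]
          ring
    _ = ∫ t, S t ∂(Measure.pi fun _ : Fin m => τ.prod τ) := by
        rw [integral_div, integral_finsetSum _ fun σ _ => hi σ]
        simp_rw [integral_comp_measurePreserving (hmp _) hSm]
        simp only [Finset.sum_const, Finset.card_univ, Fintype.card_perm, Fintype.card_fin,
          nsmul_eq_mul]
        field_simp
    _ ≤ C := hC

/-! ### The density of the joint law with respect to the product of its marginals -/

theorem fst_withDensity_prod {α β : Type*} [MeasurableSpace α] [MeasurableSpace β] (μ : Measure α)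
    [SigmaFinite μ] (ν : Measure β) [SigmaFinite ν] {p : α × β → ℝ≥0∞} (hp : Measurable p) :
    ((μ.prod ν).withDensity p).fst = μ.withDensity fun w => ∫⁻ z, p (w, z) ∂ν := by
  ext s hs
  rw [Measure.fst_apply hs, withDensity_apply _ (measurable_fst hs), withDensity_apply _ hs,
    ← Set.prod_univ, ← Measure.prod_restrict, Measure.restrict_univ, lintegral_prod _ hp.aemeasurable]

theorem snd_withDensity_prod {α β : Type*} [MeasurableSpace α] [MeasurableSpace β] (μ : Measure α)
    [SigmaFinite μ] (ν : Measure β) [SigmaFinite ν] {p : α × β → ℝ≥0∞} (hp : Measurable p) :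
    ((μ.prod ν).withDensity p).snd = ν.withDensity fun z => ∫⁻ w, p (w, z) ∂μ := by
  ext s hs
  rw [Measure.snd_apply hs, withDensity_apply _ (measurable_snd hs), withDensity_apply _ hs,
    ← Set.univ_prod, ← Measure.prod_restrict, Measure.restrict_univ,
    lintegral_prod_symm _ hp.aemeasurable]

/-- The density ratio is a density of the joint law with respect to the product of its marginals. The
convention for division by zero is harmless: almost everywhere, `p` vanishes where a marginal does. -/
theorem withDensity_densityRatio {α β : Type*} [MeasurableSpace α] [MeasurableSpace β]
    (μ : Measure α) [SigmaFinite μ] (ν : Measure β) [SigmaFinite ν] {p : α × β → ℝ≥0∞}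
    (hp : Measurable p) [IsFiniteMeasure ((μ.prod ν).withDensity p)] :
    (((μ.prod ν).withDensity p).fst.prod ((μ.prod ν).withDensity p).snd).withDensity
      (fun q => ENNReal.ofReal (densityRatio μ ν p q)) = (μ.prod ν).withDensity p := by
  set f : α → ℝ≥0∞ := fun w => ∫⁻ z, p (w, z) ∂ν with hf
  set h : β → ℝ≥0∞ := fun z => ∫⁻ w, p (w, z) ∂μ with hh
  have hfm : Measurable f := hp.lintegral_prod_right'
  have hhm : Measurable h := hp.lintegral_prod_left'
  have hdm : Measurable (densityRatio μ ν p) := by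
    unfold densityRatio
    exact (hp.div ((hfm.comp measurable_fst).mul (hhm.comp measurable_snd))).ennreal_toReal
  have hfin : ∫⁻ q, p q ∂(μ.prod ν) ≠ ∞ := by
    have := measure_ne_top ((μ.prod ν).withDensity p) Set.univ
    rwa [withDensity_apply _ MeasurableSet.univ, Measure.restrict_univ] at this
  have hffin : ∫⁻ w, f w ∂μ ≠ ∞ := by
    rwa [hf, ← lintegral_prod _ hp.aemeasurable]
  have hhfin : ∫⁻ z, h z ∂ν ≠ ∞ := by
    rwa [hh, ← lintegral_prod_symm _ hp.aemeasurable]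
  have hptop : ∀ᵐ q ∂(μ.prod ν), p q < ∞ := ae_lt_top hp hfin
  have hftop : ∀ᵐ q ∂(μ.prod ν), f q.1 < ∞ :=
    Measure.quasiMeasurePreserving_fst.ae (ae_lt_top hfm hffin)
  have hhtop : ∀ᵐ q ∂(μ.prod ν), h q.2 < ∞ :=
    Measure.quasiMeasurePreserving_snd.ae (ae_lt_top hhm hhfin)
  -- The joint density vanishes wherever one of its marginals does.
  have hf0 : ∀ᵐ q ∂(μ.prod ν), f q.1 = 0 → p q = 0 := by
    rw [Measure.ae_prod_iff_ae_ae]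
    · refine ae_of_all _ fun w => ?_
      by_cases h0 : f w = 0
      · have := (lintegral_eq_zero_iff (hp.comp measurable_prodMk_left)).mp h0
        filter_upwards [this] with z hz _ using hz
      · exact ae_of_all _ fun z hz => absurd hz h0
    · exact ((hfm.comp measurable_fst) (measurableSet_singleton 0)).imp
        (hp (measurableSet_singleton 0))
  have hh0 : ∀ᵐ q ∂(μ.prod ν), h q.2 = 0 → p q = 0 := by
    have : ∀ᵐ q ∂(ν.prod μ), h q.1 = 0 → p q.swap = 0 := by
      rw [Measure.ae_prod_iff_ae_ae]
      · refine ae_of_all _ fun w => ?_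
        by_cases h0 : h w = 0
        · have := (lintegral_eq_zero_iff (hp.comp measurable_prodMk_right)).mp h0
          filter_upwards [this] with z hz _ using hz
        · exact ae_of_all _ fun z hz => absurd hz h0
      · exact ((hhm.comp measurable_fst) (measurableSet_singleton 0)).imp
          ((hp.comp measurable_swap) (measurableSet_singleton 0))
    exact (Measure.measurePreserving_swap (μ := μ) (ν := ν)).quasiMeasurePreserving.ae this
  have hfhm : Measurable fun q : α × β => f q.1 * h q.2 :=
    (hfm.comp measurable_fst).mul (hhm.comp measurable_snd)
  rw [fst_withDensity_prod μ ν hp, snd_withDensity_prod μ ν hp, prod_withDensity hfm hhm,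
    ← withDensity_mul _ hfhm hdm.ennreal_ofReal]
  refine withDensity_congr_ae ?_
  filter_upwards [hptop, hftop, hhtop, hf0, hh0] with q h1 h2 h3 h4 h5
  by_cases h6 : f q.1 * h q.2 = 0
  · have : p q = 0 := by
      rcases mul_eq_zero.mp h6 with h | h
      · exact h4 h
      · exact h5 h
    simp [h6, this]
  · have h7 : f q.1 * h q.2 ≠ ∞ := (ENNReal.mul_lt_top h2 h3).ne
    have h8 : densityRatio μ ν p q = (p q / (f q.1 * h q.2)).toReal := rfl
    rw [Pi.mul_apply, h8, ENNReal.ofReal_toReal (ENNReal.div_lt_top h1.ne h6).ne]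
    exact ENNReal.mul_div_cancel h6 h7

/-! ### The excess loss -/

/-- The kernel of the excess empirical risk of `r` over `r₀`: at a pair `((w, z), (w', z'))` of
sample points, the linear term of the risk is evaluated at `(w, z)` and the quadratic one at
`(w, z')`, so that the two coordinates of the latter are independent. -/
noncomputable def excessLoss {α β : Type*} (r₀ r : α × β → ℝ) (v : (α × β) × (α × β)) : ℝ :=
  -(r v.1 - r₀ v.1) + 1 / 2 * (r (v.1.1, v.2.2) ^ 2 - r₀ (v.1.1, v.2.2) ^ 2)

theorem abs_sq_sub_sq_le {B x y : ℝ} (hx : |x| ≤ B) (hy : |y| ≤ B) : |x ^ 2 - y ^ 2| ≤ B ^ 2 := by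
  have h1 : x ^ 2 ≤ B ^ 2 := sq_le_sq' (abs_le.mp hx).1 (abs_le.mp hx).2
  have h2 : y ^ 2 ≤ B ^ 2 := sq_le_sq' (abs_le.mp hy).1 (abs_le.mp hy).2
  exact abs_le.mpr ⟨by nlinarith [sq_nonneg x], by nlinarith [sq_nonneg y]⟩

theorem integrable_of_abs_le {T : Type*} [MeasurableSpace T] {ρ : Measure T} [IsFiniteMeasure ρ]
    {f : T → ℝ} (hf : Measurable f) {C : ℝ} (hC : ∀ x, |f x| ≤ C) : Integrable f ρ :=
  Integrable.of_bound hf.aestronglyMeasurable C (ae_of_all _ hC)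

section ExcessLoss

variable {α β : Type*} {r₀ r r' : α × β → ℝ} {B : ℝ}

theorem measurable_excessLoss [MeasurableSpace α] [MeasurableSpace β] (hr₀ : Measurable r₀)
    (hr : Measurable r) : Measurable (excessLoss r₀ r) := by
  unfold excessLoss
  fun_prop

theorem abs_excessLoss_le (hB₀ : ∀ q, |r₀ q| ≤ B) (hB : ∀ q, |r q| ≤ B)
    (v : (α × β) × (α × β)) : |excessLoss r₀ r v| ≤ 2 * B + B ^ 2 := by
  have h1 := hB v.1
  have h2 := hB₀ v.1
  have h3 := abs_sq_sub_sq_le (hB (v.1.1, v.2.2)) (hB₀ (v.1.1, v.2.2))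
  unfold excessLoss
  rw [abs_le] at *
  constructor <;> nlinarith [sq_nonneg B]

theorem abs_excessLoss_sub_le (hB : ∀ q, |r q| ≤ B) (hB' : ∀ q, |r' q| ≤ B) {η : ℝ}
    {v : (α × β) × (α × β)} (h1 : |r v.1 - r' v.1| ≤ η)
    (h2 : |r (v.1.1, v.2.2) - r' (v.1.1, v.2.2)| ≤ η) :
    |excessLoss r₀ r v - excessLoss r₀ r' v| ≤ (1 + B) * η := by
  have h3 : |r (v.1.1, v.2.2) ^ 2 - r' (v.1.1, v.2.2) ^ 2| ≤ 2 * B * η := by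
    rw [sq_sub_sq, abs_mul]
    have h4 := hB (v.1.1, v.2.2)
    refine mul_le_mul ?_ h2 (abs_nonneg _) ?_
    · exact (abs_add_le _ _).trans (by linarith [hB' (v.1.1, v.2.2)])
    · linarith [abs_nonneg (r (v.1.1, v.2.2))]
  unfold excessLoss
  rw [abs_le] at *
  constructor <;> linarith

/-- The error term accounts for the diagonal of the double sum in the risk. -/
theorem uStatistic_excessLoss_le {n : ℕ} (hn : 2 ≤ n) (hB₀ : ∀ q, |r₀ q| ≤ B) (hB : ∀ q, |r q| ≤ B)
    (W : ℕ → α) (Z : ℕ → β) :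
    uStatistic (fun i : Fin n => (W i, Z i)) (excessLoss r₀ r) ≤
      lsifRisk n W Z r - lsifRisk n W Z r₀ + B ^ 2 / n := by
  have hn' : (2 : ℝ) ≤ n := by exact_mod_cast hn
  set f : Fin n × Fin n → ℝ := fun p => r (W p.1, Z p.2) ^ 2 - r₀ (W p.1, Z p.2) ^ 2 with hf
  have hfb : ∀ p, |f p| ≤ B ^ 2 := fun p => abs_sq_sub_sq_le (hB _) (hB₀ _)
  set H : ℝ := ∑ i : Fin n, (r (W i, Z i) - r₀ (W i, Z i)) with hH
  set D : ℝ := ∑ p ∈ (Finset.univ : Finset (Fin n)).offDiag, f p with hD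
  set T : ℝ := ∑ p ∈ (Finset.univ : Finset (Fin n)).diag, f p with hT
  have hcardD : (((Finset.univ : Finset (Fin n)).offDiag.card : ℕ) : ℝ) = n * (n - 1) := by
    rw [Finset.offDiag_card, Nat.cast_sub (Nat.le_mul_self _)]
    simp
    ring
  have hDb : |D| ≤ n * (n - 1) * B ^ 2 := by
    refine (Finset.abs_sum_le_sum_abs _ _).trans ((Finset.sum_le_sum fun p _ => hfb p).trans ?_)
    rw [Finset.sum_const, nsmul_eq_mul, hcardD]
  have hTb : |T| ≤ n * B ^ 2 := by
    refine (Finset.abs_sum_le_sum_abs _ _).trans ((Finset.sum_le_sum fun p _ => hfb p).trans ?_)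
    rw [Finset.sum_const, nsmul_eq_mul, Finset.diag_card]
    simp
  have hall : ∑ j : Fin n, ∑ i : Fin n, f (i, j) = T + D := by
    rw [hT, hD, ← Finset.sum_union (Finset.disjoint_diag_offDiag _), Finset.diag_union_offDiag,
      Finset.sum_product_right]
  have hHsum : ∑ p ∈ (Finset.univ : Finset (Fin n)).offDiag,
      (r (W p.1, Z p.1) - r₀ (W p.1, Z p.1)) = (n - 1) * H := by
    have h1 : ∑ p ∈ (Finset.univ : Finset (Fin n)).diag ∪ (Finset.univ : Finset (Fin n)).offDiag,
        (r (W p.1, Z p.1) - r₀ (W p.1, Z p.1)) = n * H := by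
      rw [Finset.diag_union_offDiag, Finset.sum_product]
      simp only [hH, Finset.sum_const, Finset.card_univ, Fintype.card_fin, nsmul_eq_mul,
        Finset.mul_sum]
    rw [Finset.sum_union (Finset.disjoint_diag_offDiag _), Finset.sum_diag] at h1
    linarith
  have hU : uStatistic (fun i : Fin n => (W i, Z i)) (excessLoss r₀ r) =
      (-((n - 1) * H) + 1 / 2 * D) / (n * (n - 1)) := by
    unfold uStatistic excessLoss
    rw [Finset.sum_add_distrib, Finset.sum_neg_distrib, hHsum, ← Finset.mul_sum]
  have hL : lsifRisk n W Z r - lsifRisk n W Z r₀ = -(H / n) + 1 / 2 * ((T + D) / n ^ 2) := by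
    rw [← hall]
    unfold lsifRisk
    simp only [hH, hf, Finset.sum_range, ← Finset.mul_sum, Finset.sum_sub_distrib]
    field_simp
    ring
  rw [hU, hL]
  have hn1 : (0 : ℝ) < n - 1 := by linarith
  have hn0 : (0 : ℝ) < n := by linarith
  have h1 : (-((n - 1) * H) + 1 / 2 * D) / (n * (n - 1)) = -(H / n) + 1 / 2 * ((T + D) / n ^ 2)
      + 1 / 2 * (D / (n ^ 2 * (n - 1))) - 1 / 2 * (T / n ^ 2) := by
    field_simp
    ring
  have h2 : D / (n ^ 2 * (n - 1)) ≤ B ^ 2 / n := by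
    rw [div_le_div_iff₀ (by positivity) hn0]
    nlinarith [(abs_le.mp hDb).2]
  have h3 : -(B ^ 2 / n) ≤ T / n ^ 2 := by
    rw [← neg_div, div_le_div_iff₀ hn0 (by positivity)]
    nlinarith [(abs_le.mp hTb).1]
  rw [h1]
  linarith

variable [MeasurableSpace α] [MeasurableSpace β] {O : Measure (α × β)}

theorem measurePreserving_cross (O : Measure (α × β)) [IsProbabilityMeasure O] :
    MeasurePreserving (fun v : (α × β) × (α × β) => (v.1.1, v.2.2)) (O.prod O)
      (O.fst.prod O.snd) :=
  MeasurePreserving.prod (f := Prod.fst) (g := Prod.snd) ⟨measurable_fst, rfl⟩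
    ⟨measurable_snd, rfl⟩

theorem integral_eq_integral_ratio_mul (hr₀ : Measurable r₀)
    (hO : (O.fst.prod O.snd).withDensity (fun q => ENNReal.ofReal (r₀ q)) = O)
    (hpos : ∀ᵐ q ∂(O.fst.prod O.snd), 0 ≤ r₀ q) (f : α × β → ℝ) :
    ∫ q, f q ∂O = ∫ q, r₀ q * f q ∂(O.fst.prod O.snd) := by
  conv_lhs => rw [← hO]
  rw [integral_withDensity_eq_integral_toReal_smul hr₀.ennreal_ofReal
    (ae_of_all _ fun q => ENNReal.ofReal_lt_top)]
  refine integral_congr_ae ?_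
  filter_upwards [hpos] with q hq
  rw [ENNReal.toReal_ofReal hq, smul_eq_mul]

variable [IsProbabilityMeasure O]

theorem integrable_sq_sub {ρ : Measure (α × β)} [IsFiniteMeasure ρ] (hr₀ : Measurable r₀)
    (hr : Measurable r) (hB₀ : ∀ q, |r₀ q| ≤ B) (hB : ∀ q, |r q| ≤ B) :
    Integrable (fun q => (r q - r₀ q) ^ 2) ρ := by
  refine integrable_of_abs_le (by fun_prop) (C := (2 * B) ^ 2) fun q => ?_
  rw [abs_pow]
  refine pow_le_pow_left₀ (abs_nonneg _) ?_ 2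
  exact (abs_sub _ _).trans (by linarith [hB q, hB₀ q])

theorem integral_sq_sub_le (hr₀ : Measurable r₀)
    (hO : (O.fst.prod O.snd).withDensity (fun q => ENNReal.ofReal (r₀ q)) = O)
    (hpos : ∀ᵐ q ∂(O.fst.prod O.snd), 0 ≤ r₀ q) (hr : Measurable r) (hB₀ : ∀ q, |r₀ q| ≤ B)
    (hB : ∀ q, |r q| ≤ B) :
    ∫ q, (r q - r₀ q) ^ 2 ∂O ≤ B * ∫ q, (r q - r₀ q) ^ 2 ∂(O.fst.prod O.snd) := by
  rw [integral_eq_integral_ratio_mul hr₀ hO hpos, ← integral_const_mul]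
  have hi : Integrable (fun q => (r q - r₀ q) ^ 2) (O.fst.prod O.snd) :=
    integrable_sq_sub hr₀ hr hB₀ hB
  refine integral_mono (hi.bdd_mul hr₀.aestronglyMeasurable (ae_of_all _ hB₀))
    (hi.const_mul B) fun q => ?_
  exact mul_le_mul_of_nonneg_right ((le_abs_self _).trans (hB₀ q)) (sq_nonneg _)

/-- The population excess risk of `r` over the density ratio `r₀` is half a squared `L²` distance. -/
theorem integral_excessLoss (hr₀ : Measurable r₀)
    (hO : (O.fst.prod O.snd).withDensity (fun q => ENNReal.ofReal (r₀ q)) = O)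
    (hpos : ∀ᵐ q ∂(O.fst.prod O.snd), 0 ≤ r₀ q) (hr : Measurable r) (hB₀ : ∀ q, |r₀ q| ≤ B)
    (hB : ∀ q, |r q| ≤ B) :
    ∫ v, excessLoss r₀ r v ∂(O.prod O) =
      1 / 2 * ∫ q, (r q - r₀ q) ^ 2 ∂(O.fst.prod O.snd) := by
  have hd : ∀ q, |r q - r₀ q| ≤ 2 * B := fun q =>
    (abs_sub _ _).trans (by linarith [hB q, hB₀ q])
  have h1 : ∫ v : (α × β) × (α × β), r v.1 - r₀ v.1 ∂(O.prod O) =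
      ∫ q, r₀ q * (r q - r₀ q) ∂(O.fst.prod O.snd) := by
    rw [← integral_eq_integral_ratio_mul hr₀ hO hpos]
    exact integral_comp_measurePreserving measurePreserving_fst (g := fun q => r q - r₀ q)
      (hr.sub hr₀)
  have h2 : ∫ v : (α × β) × (α × β), (r (v.1.1, v.2.2) ^ 2 - r₀ (v.1.1, v.2.2) ^ 2) ∂(O.prod O) =
      ∫ q, (r q ^ 2 - r₀ q ^ 2) ∂(O.fst.prod O.snd) :=
    integral_comp_measurePreserving (measurePreserving_cross O)
      (g := fun q => r q ^ 2 - r₀ q ^ 2) ((hr.pow_const 2).sub (hr₀.pow_const 2))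
  unfold excessLoss
  rw [integral_add, integral_neg, integral_const_mul, h1, h2, ← integral_neg, ← integral_const_mul,
    ← integral_const_mul, ← integral_add]
  · exact integral_congr_ae (ae_of_all _ fun q => by ring)
  · exact ((integrable_of_abs_le (hr.sub hr₀) hd).bdd_mul hr₀.aestronglyMeasurable
      (ae_of_all _ hB₀)).neg
  · exact (integrable_of_abs_le (by fun_prop)
      fun q => abs_sq_sub_sq_le (hB q) (hB₀ q)).const_mul _
  · exact (integrable_of_abs_le (by fun_prop)
      fun v : (α × β) × (α × β) => hd v.1).neg
  · exact (integrable_of_abs_le (by fun_prop) fun v : (α × β) × (α × β) =>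
      abs_sq_sub_sq_le (hB (v.1.1, v.2.2)) (hB₀ (v.1.1, v.2.2))).const_mul _

/-- The Bernstein condition of the excess loss. -/
theorem integral_excessLoss_sq_le (hr₀ : Measurable r₀)
    (hO : (O.fst.prod O.snd).withDensity (fun q => ENNReal.ofReal (r₀ q)) = O)
    (hpos : ∀ᵐ q ∂(O.fst.prod O.snd), 0 ≤ r₀ q) (hr : Measurable r) (hB₀ : ∀ q, |r₀ q| ≤ B)
    (hB : ∀ q, |r q| ≤ B) :
    ∫ v, excessLoss r₀ r v ^ 2 ∂(O.prod O) ≤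
      (4 * B + 4 * B ^ 2) * ∫ v, excessLoss r₀ r v ∂(O.prod O) := by
  have hm : Measurable fun q => (r q - r₀ q) ^ 2 := (hr.sub hr₀).pow_const 2
  have hb : ∀ q, |(r q - r₀ q) ^ 2| ≤ (2 * B) ^ 2 := fun q => by
    rw [abs_pow]
    refine pow_le_pow_left₀ (abs_nonneg _) ?_ 2
    exact (abs_sub _ _).trans (by linarith [hB q, hB₀ q])
  have hi1 : Integrable (fun v : (α × β) × (α × β) => 2 * (r v.1 - r₀ v.1) ^ 2) (O.prod O) :=
    (integrable_of_abs_le (hm.comp measurable_fst) fun v => hb v.1).const_mul 2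
  have hi2 : Integrable (fun v : (α × β) × (α × β) =>
      2 * B ^ 2 * (r (v.1.1, v.2.2) - r₀ (v.1.1, v.2.2)) ^ 2) (O.prod O) :=
    (integrable_of_abs_le (hm.comp (measurePreserving_cross O).measurable)
      fun v => hb (v.1.1, v.2.2)).const_mul _
  calc ∫ v, excessLoss r₀ r v ^ 2 ∂(O.prod O)
      ≤ ∫ v : (α × β) × (α × β), (2 * (r v.1 - r₀ v.1) ^ 2
          + 2 * B ^ 2 * (r (v.1.1, v.2.2) - r₀ (v.1.1, v.2.2)) ^ 2) ∂(O.prod O) := by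
        refine integral_mono_of_nonneg (ae_of_all _ fun v => sq_nonneg _) (hi1.add hi2)
          (ae_of_all _ fun v => ?_)
        simp only [excessLoss]
        set x := r v.1 - r₀ v.1
        set y := r (v.1.1, v.2.2) with hy
        set z := r₀ (v.1.1, v.2.2) with hz
        have h1 : (y + z) ^ 2 ≤ (2 * B) ^ 2 := by
          have h2 := abs_le.mp (hB (v.1.1, v.2.2))
          have h3 := abs_le.mp (hB₀ (v.1.1, v.2.2))
          exact sq_le_sq' (by linarith) (by linarith)
        have h4 : (y ^ 2 - z ^ 2) ^ 2 ≤ (2 * B) ^ 2 * (y - z) ^ 2 := by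
          rw [sq_sub_sq, mul_pow]
          exact mul_le_mul_of_nonneg_right h1 (sq_nonneg _)
        nlinarith [sq_nonneg (x + 1 / 2 * (y ^ 2 - z ^ 2))]
    _ = 2 * ∫ q, (r q - r₀ q) ^ 2 ∂O + 2 * B ^ 2 * ∫ q, (r q - r₀ q) ^ 2 ∂(O.fst.prod O.snd) := by
        rw [integral_add hi1 hi2, integral_const_mul, integral_const_mul,
          integral_comp_measurePreserving (measurePreserving_fst (μ := O) (ν := O)) hm,
          integral_comp_measurePreserving (measurePreserving_cross O) hm]
    _ ≤ (4 * B + 4 * B ^ 2) * ∫ v, excessLoss r₀ r v ∂(O.prod O) := by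
        rw [integral_excessLoss hr₀ hO hpos hr hB₀ hB]
        linarith [integral_sq_sub_le hr₀ hO hpos hr hB₀ hB]

end ExcessLoss

/-! ### Separability of the class -/

/-- Only the finiteness of the covering numbers matters here, not their size. -/
theorem exists_countable_dense_of_entropy {α : Type*} {R : Set (α → ℝ)}
    {I : (α → ℝ) → ℝ≥0∞} (hstrat : R = ⋃ (M : ℝ) (_ : 1 ≤ M), stratum R I M) {γ A : ℝ}
    (hent : ∀ M : ℝ, 1 ≤ M → ∀ δ : ℝ≥0, 0 < δ →
      ENNReal.log (supCoveringNumber δ (stratum R I M) : ℝ≥0∞) ≤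
        ((A * (M / δ) ^ γ : ℝ) : EReal)) :
    ∃ D ⊆ R, D.Countable ∧ ∀ r ∈ R, ∀ η : ℝ, 0 < η → ∃ r' ∈ D, ∀ x, |r x - r' x| ≤ η := by
  have hnat : ∀ r ∈ R, ∃ k : ℕ, r ∈ stratum R I ((k : ℝ) + 1) := by
    intro r hr
    rw [hstrat] at hr
    simp only [Set.mem_iUnion] at hr
    obtain ⟨M, -, hM⟩ := hr
    obtain ⟨k, hk⟩ := exists_nat_ge M
    exact ⟨k, hM.1, hM.2.trans (ENNReal.ofReal_le_ofReal (by linarith))⟩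
  obtain ⟨t, htR, htc, ht⟩ := EMetric.subset_countable_closure_of_almost_dense_set
    ((UniformFun.ofFun : (α → ℝ) → (α →ᵤ ℝ)) '' R) (by
      intro ε hε
      obtain ⟨δ, hδ0, hδ⟩ := ENNReal.lt_iff_exists_nnreal_btwn.mp hε
      have hδ0' : 0 < δ := by exact_mod_cast hδ0
      have hfin : ∀ k : ℕ, ∃ C : Set (α →ᵤ ℝ), C.Countable ∧
          Metric.IsCover δ ((UniformFun.ofFun : (α → ℝ) → (α →ᵤ ℝ)) ''
            stratum R I ((k : ℝ) + 1)) C := by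
        intro k
        have h1 := hent ((k : ℝ) + 1) (by linarith [Nat.cast_nonneg (α := ℝ) k]) δ hδ0'
        have h2 : supCoveringNumber δ (stratum R I ((k : ℝ) + 1)) ≠ ⊤ := by
          intro h
          rw [h, ENat.toENNReal_top, ENNReal.log_top, top_le_iff] at h1
          exact EReal.coe_ne_top _ h1
        by_contra! hno
        refine h2 (iInf₂_eq_top.mpr fun C hC => ?_)
        by_contra hfin
        exact hno C (Set.encard_ne_top_iff.mp hfin).countable hC
      choose C hCc hC using hfin
      refine ⟨⋃ k, C k, Set.countable_iUnion hCc, ?_⟩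
      rintro _ ⟨r, hr, rfl⟩
      obtain ⟨k, hk⟩ := hnat r hr
      obtain ⟨y, hy, hd⟩ := hC k ⟨r, hk, rfl⟩
      refine Set.mem_iUnion₂.mpr ⟨y, Set.mem_iUnion.mpr ⟨k, hy⟩, ?_⟩
      exact (show edist (UniformFun.ofFun r) y ≤ δ from hd).trans hδ.le)
  refine ⟨UniformFun.ofFun ⁻¹' t, ?_, htc.preimage UniformFun.ofFun.injective, ?_⟩
  · intro r hr
    obtain ⟨r', hr', he⟩ := htR hr
    rwa [← UniformFun.ofFun.injective he]
  · intro r hr η hη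
    have h1 := ht ⟨r, hr, rfl⟩
    obtain ⟨y, hy, hd⟩ := EMetric.mem_closure_iff.mp h1 (ENNReal.ofReal η) (by simpa using hη)
    refine ⟨UniformFun.toFun y, by simpa using hy, fun x => ?_⟩
    have h2 := (UniformFun.edist_eval_le (x := x)).trans hd.le
    rw [edist_dist, ENNReal.ofReal_le_ofReal_iff hη.le, Real.dist_eq] at h2
    simpa using h2

/-! ### Uniform one-sided deviations of the excess risk -/

section Tail

variable {Ω α β : Type*} [MeasurableSpace Ω] [MeasurableSpace α] [MeasurableSpace β]
  {ρ : Measure Ω} {O : Measure (α × β)}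
  {V : ℕ → Ω → α × β} {R : Set (α × β → ℝ)} {B : ℝ} {r₀ : α × β → ℝ}

/-- The deviation `∫ g - 2 U g`, where `g` is the excess loss of `r` over `r₀` and `U g` its
U-statistic. -/
noncomputable def excessDeviation (O : Measure (α × β)) (r₀ : α × β → ℝ) {n : ℕ}
    (v : Fin n → α × β) (r : α × β → ℝ) : ℝ :=
  ∫ x, excessLoss r₀ r x ∂(O.prod O) - 2 * uStatistic v (excessLoss r₀ r)

theorem measurable_excessDeviation (hV : ∀ i, Measurable (V i)) {r : α × β → ℝ}
    (hr₀ : Measurable r₀) (hr : Measurable r) (n : ℕ) :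
    Measurable fun ω => excessDeviation O r₀ (fun i : Fin n => V i ω) r := by
  unfold excessDeviation uStatistic
  refine measurable_const.sub (measurable_const.mul (Measurable.div_const ?_ _))
  exact Finset.measurable_sum _ fun p _ =>
    (measurable_excessLoss hr₀ hr).comp ((hV _).prodMk (hV _))

variable [IsProbabilityMeasure ρ] [IsProbabilityMeasure O]

/-- The expected supremum of the deviations over a finite subclass, with a constant that does not
depend on the subclass. -/
theorem exists_integral_sup_excessDeviation_le (hV : ∀ i, Measurable (V i))
    (hindep : iIndepFun V ρ) (hlaw : ∀ i, ρ.map (V i) = O) (hRm : ∀ r ∈ R, Measurable r)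
    (hVC : IsVCFunctionClass R) (hB : 0 < B) (hbdd : ∀ r ∈ R, ∀ q, |r q| ≤ B) (hr₀ : r₀ ∈ R)
    (hO : (O.fst.prod O.snd).withDensity (fun q => ENNReal.ofReal (r₀ q)) = O)
    (hpos : ∀ᵐ q ∂(O.fst.prod O.snd), 0 ≤ r₀ q) {a : ℝ} (ha0 : 0 < a) (ha1 : a < 1) :
    ∃ C : ℝ, 0 < C ∧ ∀ n : ℕ, 2 ≤ n → ∀ (F : Finset R) (hF : F.Nonempty),
      ∫ ω, F.sup' hF (fun r => excessDeviation O r₀ (fun i : Fin n => V i ω) r.1) ∂ρ ≤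
        C * (n : ℝ) ^ (-a) := by
  classical
  obtain ⟨d, hd⟩ := hVC
  set c : ℝ := 4 * B + 4 * B ^ 2 with hc
  set b : ℝ := 2 * B + B ^ 2 with hb
  have hc0 : 0 < c := by positivity
  have hb0 : 0 < b := by positivity
  obtain ⟨C, hC0, hC⟩ := exists_log_cover_div_le_rpow d (c₁ := 2 * c * (2 + b / c) ^ 2)
    (c₂ := (4 + 2 * b / c) * (1 + B)) hB.le ha0 ha1 (by positivity) (by positivity)
  refine ⟨C, hC0, fun n hn F hF => ?_⟩
  set m : ℕ := n / 2 with hm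
  have hm0 : 0 < m := by omega
  have hgm : ∀ r : R, Measurable (excessLoss r₀ r.1) := fun r =>
    measurable_excessLoss (hRm _ hr₀) (hRm _ r.2)
  have hgb : ∀ (r : R) x, |excessLoss r₀ r.1 x| ≤ b := fun r x =>
    abs_excessLoss_le (hbdd _ hr₀) (hbdd _ r.2) x
  have hE : ∀ r : R, |∫ x, excessLoss r₀ r.1 x ∂(O.prod O)| ≤ b := fun r => by
    simpa using norm_integral_le_of_norm_le_const (μ := O.prod O) (f := excessLoss r₀ r.1)
      (ae_of_all _ (hgb r))
  refine integral_sup_uStatistic_le (V := fun (i : Fin n) ω => V i ω) (τ := O)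
    (g := fun r : R => excessLoss r₀ r.1) (fun i => hV i) (hindep.precomp Fin.val_injective)
    (fun i => hlaw i) hF hgm hgb hE hm0 (by omega) ?_
  refine (integral_sup_sub_two_mul_average_le (O.prod O) hF hgm hc0 hb0.le hgb
    (η := (1 + B) * (1 / (m : ℝ)))
    (N := (4 * m * (2 * ⌈B * m⌉₊ + 1) + 1) ^ d) (fun r => ?_) hm0 fun u => ?_).trans ?_
  · exact integral_excessLoss_sq_le (hRm _ hr₀) hO hpos (hRm _ r.2) (hbdd _ hr₀) (hbdd _ r.2)
  · -- The points at which the functions of the class enter the losses at `u`.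
    set S : Finset (α × β) :=
      (Finset.univ.image (fun i => (u i).1.1) ∪
        Finset.univ.image (fun i => ((u i).1.1.1, (u i).1.2.2))) ∪
      (Finset.univ.image (fun i => (u i).2.1) ∪
        Finset.univ.image (fun i => ((u i).2.1.1, (u i).2.2.2))) with hS
    have hcard : S.card ≤ 4 * m := by
      have him : ∀ f : Fin m → α × β, (Finset.univ.image f).card ≤ m := fun f =>
        Finset.card_image_le.trans (by simp)
      refine (Finset.card_union_le _ _).trans ?_
      have h1 := (Finset.card_union_le (Finset.univ.image (fun i => (u i).1.1))
        (Finset.univ.image (fun i => ((u i).1.1.1, (u i).1.2.2)))).trans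
          (Nat.add_le_add (him _) (him _))
      have h2 := (Finset.card_union_le (Finset.univ.image (fun i => (u i).2.1))
        (Finset.univ.image (fun i => ((u i).2.1.1, (u i).2.2.2)))).trans
          (Nat.add_le_add (him _) (him _))
      omega
    obtain ⟨F₀, hF₀, hN, hcov⟩ := exists_empirical_cover hd hbdd F S hm0
    refine ⟨F₀, hF₀, hN.trans (Nat.pow_le_pow_left (by gcongr) d), fun r hr => ?_⟩
    obtain ⟨r', hr', h⟩ := hcov r hr
    refine ⟨r', hr', fun i => ⟨?_, ?_⟩⟩
    · refine abs_excessLoss_sub_le (hbdd _ r.2) (hbdd _ r'.2) (h _ ?_) (h _ ?_)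
      · simp [hS]
      · refine Finset.mem_union_left _ (Finset.mem_union_right _ ?_)
        exact Finset.mem_image_of_mem (fun i => ((u i).1.1.1, (u i).1.2.2)) (Finset.mem_univ i)
    · refine abs_excessLoss_sub_le (hbdd _ r.2) (hbdd _ r'.2) (h _ ?_) (h _ ?_)
      · simp [hS]
      · refine Finset.mem_union_right _ (Finset.mem_union_right _ ?_)
        exact Finset.mem_image_of_mem (fun i => ((u i).2.1.1, (u i).2.2.2)) (Finset.mem_univ i)
  · rw [← mul_assoc (4 + 2 * b / c)]
    exact hC n hn

/-- The deviation is Lipschitz in the sup norm. -/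
theorem excessDeviation_le_add {r r' : α × β → ℝ} (hr₀m : Measurable r₀) (hr : Measurable r)
    (hr' : Measurable r') (hB₀ : ∀ q, |r₀ q| ≤ B) (hB : ∀ q, |r q| ≤ B) (hB' : ∀ q, |r' q| ≤ B)
    {n : ℕ} (hn : 2 ≤ n) (v : Fin n → α × β) {η : ℝ} (h : ∀ q, |r q - r' q| ≤ η) :
    excessDeviation O r₀ v r ≤ excessDeviation O r₀ v r' + 3 * ((1 + B) * η) := by
  have hd : ∀ x, |excessLoss r₀ r x - excessLoss r₀ r' x| ≤ (1 + B) * η := fun x =>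
    abs_excessLoss_sub_le hB hB' (h _) (h _)
  have h1 := abs_uStatistic_le hn v hd
  rw [uStatistic_sub v (excessLoss r₀ r) (excessLoss r₀ r')] at h1
  have h2 : |∫ x, (excessLoss r₀ r x - excessLoss r₀ r' x) ∂(O.prod O)| ≤ (1 + B) * η := by
    simpa using norm_integral_le_of_norm_le_const (μ := O.prod O)
      (f := fun x => excessLoss r₀ r x - excessLoss r₀ r' x) (ae_of_all _ hd)
  rw [integral_sub (integrable_of_abs_le (measurable_excessLoss hr₀m hr) (abs_excessLoss_le hB₀ hB))
    (integrable_of_abs_le (measurable_excessLoss hr₀m hr') (abs_excessLoss_le hB₀ hB'))] at h2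
  unfold excessDeviation
  rw [abs_le] at h1 h2
  linarith

/-- Markov's inequality for the suprema over an increasing sequence of finite subclasses. Each of
them contains `r₀`, which makes the supremum nonnegative. -/
theorem measure_exists_lt_excessDeviation_le (hV : ∀ i, Measurable (V i))
    (hRm : ∀ r ∈ R, Measurable r) (hbdd : ∀ r ∈ R, ∀ q, |r q| ≤ B) (hr₀ : r₀ ∈ R) {n : ℕ}
    (hn : 2 ≤ n) {K : ℝ} (hK : ∀ (F : Finset R) (hF : F.Nonempty),
      ∫ ω, F.sup' hF (fun r => excessDeviation O r₀ (fun i : Fin n => V i ω) r.1) ∂ρ ≤ K)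
    (D : ℕ → R) {t : ℝ} (ht : 0 < t) :
    ρ {ω | ∃ k, t < excessDeviation O r₀ (fun i : Fin n => V i ω) (D k).1} ≤
      ENNReal.ofReal (K / t) := by
  classical
  set F : ℕ → Finset R := fun k => insert ⟨r₀, hr₀⟩ ((Finset.range k).image D) with hF
  have hFne : ∀ k, (F k).Nonempty := fun k => Finset.insert_nonempty _ _
  set S : ℕ → Ω → ℝ := fun k ω => (F k).sup' (hFne k)
    (fun r => excessDeviation O r₀ (fun i : Fin n => V i ω) r.1) with hS
  have hzero : ∀ ω, excessDeviation O r₀ (fun i : Fin n => V i ω) r₀ = 0 := fun ω => by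
    simp [excessDeviation, uStatistic, excessLoss]
  have hS0 : ∀ k ω, 0 ≤ S k ω := fun k ω => by
    have := Finset.le_sup' (fun r : R => excessDeviation O r₀ (fun i : Fin n => V i ω) r.1)
      (Finset.mem_insert_self ⟨r₀, hr₀⟩ ((Finset.range k).image D))
    rwa [hzero] at this
  have hdb : ∀ (r : R) ω, |excessDeviation O r₀ (fun i : Fin n => V i ω) r.1| ≤
      3 * (2 * B + B ^ 2) := fun r ω => by
    have h1 := abs_uStatistic_le hn (fun i : Fin n => V i ω)
      (abs_excessLoss_le (hbdd _ hr₀) (hbdd _ r.2))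
    have h2 : |∫ x, excessLoss r₀ r.1 x ∂(O.prod O)| ≤ 2 * B + B ^ 2 := by
      simpa using norm_integral_le_of_norm_le_const (μ := O.prod O) (f := excessLoss r₀ r.1)
        (ae_of_all _ (abs_excessLoss_le (hbdd _ hr₀) (hbdd _ r.2)))
    unfold excessDeviation
    rw [abs_le] at *
    constructor <;> linarith
  have hSi : ∀ k, Integrable (S k) ρ := fun k =>
    integrable_finset_sup' ρ (hFne k)
      (fun r => measurable_excessDeviation hV (hRm _ hr₀) (hRm _ r.2) n) hdb
  have hmono : Monotone fun k => {ω | t < S k ω} := by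
    intro k l hkl ω hω
    refine lt_of_lt_of_le (show t < S k ω from hω) ?_
    exact Finset.sup'_mono _ (Finset.insert_subset_insert _
      (Finset.image_subset_image (Finset.range_mono hkl))) _
  have hsub : {ω | ∃ k, t < excessDeviation O r₀ (fun i : Fin n => V i ω) (D k).1} ⊆
      ⋃ k, {ω | t < S k ω} := by
    rintro ω ⟨k, hk⟩
    refine Set.mem_iUnion.mpr ⟨k + 1, lt_of_lt_of_le hk ?_⟩
    exact Finset.le_sup' (fun r : R => excessDeviation O r₀ (fun i : Fin n => V i ω) r.1)
      (Finset.mem_insert_of_mem (Finset.mem_image_of_mem D (Finset.self_mem_range_succ k)))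
  refine (measure_mono hsub).trans ?_
  rw [hmono.measure_iUnion]
  refine iSup_le fun k => ?_
  have hmarkov := mul_meas_ge_le_integral_of_nonneg (ae_of_all _ (hS0 k)) (hSi k) t
  have h1 : ρ.real {ω | t < S k ω} ≤ K / t := by
    rw [le_div_iff₀' ht]
    refine (mul_le_mul_of_nonneg_left (measureReal_mono fun ω hω => ?_) ht.le).trans
      (hmarkov.trans (hK (F k) (hFne k)))
    exact (show t < S k ω from hω).le
  rw [← ofReal_measureReal]
  exact ENNReal.ofReal_le_ofReal h1

end Tail

/-! ### The rate of convergence -/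

theorem eLpNorm_two_le_ofReal {T : Type*} [MeasurableSpace T] {ρ : Measure T} [IsFiniteMeasure ρ]
    {f : T → ℝ} (hf : Measurable f) {C s : ℝ} (hC : ∀ x, |f x| ≤ C) (hs : 0 ≤ s)
    (h : ∫ x, f x ^ 2 ∂ρ ≤ s ^ 2) : eLpNorm f 2 ρ ≤ ENNReal.ofReal s := by
  have hmem : MemLp f 2 ρ := MemLp.of_bound hf.aestronglyMeasurable C (ae_of_all _ hC)
  rw [hmem.eLpNorm_eq_integral_rpow_norm (by norm_num) (by norm_num)]
  refine ENNReal.ofReal_le_ofReal ?_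
  have h1 : ∫ x, ‖f x‖ ^ (2 : ℝ≥0∞).toReal ∂ρ = ∫ x, f x ^ 2 ∂ρ := by
    refine integral_congr_ae (ae_of_all _ fun x => ?_)
    simp
  rw [h1, ENNReal.toReal_ofNat, ← one_div, ← Real.sqrt_eq_rpow]
  exact Real.sqrt_le_iff.mpr ⟨hs, h⟩

/-- The event in `htail` is given by its complement, which includes the failure of `rhat n ω ∈ R`, so
that it applies to estimators that lie in the class only almost surely. -/
theorem isBigOInProbability_of_integral_sq {Ω T : Type*} [MeasurableSpace Ω] [MeasurableSpace T]
    {Pr : Measure Ω} {ρ ρ' : Measure T} [IsFiniteMeasure ρ] {R : Set (T → ℝ)} {r₀ : T → ℝ} {B : ℝ}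
    (hRm : ∀ r ∈ R, Measurable r) (hbdd : ∀ r ∈ R, ∀ q, |r q| ≤ B) (hr₀ : r₀ ∈ R) {L : ℝ}
    (hL0 : 0 < L)
    (hL : ∀ r ∈ R, ∫ q, (r q - r₀ q) ^ 2 ∂ρ ≤ L * ∫ q, (r q - r₀ q) ^ 2 ∂ρ')
    {rhat : ℕ → Ω → T → ℝ} {a : ℝ}
    (htail : ∀ ε : ℝ, 0 < ε → ∃ C : ℝ, 0 < C ∧ ∀ᶠ n : ℕ in atTop,
      Pr {ω | ¬ (rhat n ω ∈ R ∧ ∫ q, (rhat n ω q - r₀ q) ^ 2 ∂ρ' ≤ C * (n : ℝ) ^ (2 * a))} ≤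
        ENNReal.ofReal ε) :
    IsBigOInProbability Pr (fun n ω => eLpNorm (rhat n ω - r₀) 2 ρ) (fun n => (n : ℝ) ^ a) := by
  intro ε hε
  obtain ⟨C, hC0, hC⟩ := htail ε hε
  refine ⟨Real.sqrt (L * C), by positivity, ?_⟩
  filter_upwards [hC] with n hn
  refine (measure_mono fun ω hω => ?_).trans hn
  rintro ⟨hR, hle⟩
  refine absurd (show ENNReal.ofReal _ < eLpNorm _ _ _ from hω) (not_lt.mpr ?_)
  refine eLpNorm_two_le_ofReal ((hRm _ hR).sub (hRm _ hr₀)) (C := 2 * B) (fun q => ?_)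
    (by positivity) ?_
  · exact (abs_sub _ _).trans (by linarith [hbdd _ hR q, hbdd _ hr₀ q])
  · rw [mul_pow, Real.sq_sqrt (by positivity), ← Real.rpow_mul_natCast (Nat.cast_nonneg n)]
    refine (hL _ hR).trans ?_
    rw [mul_assoc L, Nat.cast_ofNat, mul_comm a]
    exact mul_le_mul_of_nonneg_left hle hL0.le

section Rate

variable {Ω α β : Type*} [MeasurableSpace Ω] [MeasurableSpace α] [MeasurableSpace β]
  {ρ : Measure Ω} [IsProbabilityMeasure ρ] {O : Measure (α × β)} [IsProbabilityMeasure O]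
  {V : ℕ → Ω → α × β} {R : Set (α × β → ℝ)} {B : ℝ} {r₀ : α × β → ℝ}

theorem exists_measure_lt_integral_sq_le (hV : ∀ i, Measurable (V i))
    (hindep : iIndepFun V ρ) (hlaw : ∀ i, ρ.map (V i) = O) (hRm : ∀ r ∈ R, Measurable r)
    (hVC : IsVCFunctionClass R) (hB : 0 < B) (hbdd : ∀ r ∈ R, ∀ q, |r q| ≤ B) (hr₀ : r₀ ∈ R)
    (hO : (O.fst.prod O.snd).withDensity (fun q => ENNReal.ofReal (r₀ q)) = O)
    (hpos : ∀ᵐ q ∂(O.fst.prod O.snd), 0 ≤ r₀ q)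
    (hsep : ∃ D ⊆ R, D.Countable ∧ ∀ r ∈ R, ∀ η : ℝ, 0 < η → ∃ r' ∈ D, ∀ x, |r x - r' x| ≤ η)
    {rhat : ℕ → Ω → α × β → ℝ} (hrhat : ∀ n, 1 ≤ n → ∀ᵐ ω ∂ρ, rhat n ω ∈ R ∧
      IsMinOn (lsifRisk n (fun i => (V i ω).1) (fun i => (V i ω).2)) R (rhat n ω))
    {a : ℝ} (ha0 : 0 < a) (ha1 : a < 1) {ε : ℝ} (hε : 0 < ε) :
    ∃ C : ℝ, 0 < C ∧ ∀ᶠ n : ℕ in atTop,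
      ρ {ω | ¬ (rhat n ω ∈ R ∧
        ∫ q, (rhat n ω q - r₀ q) ^ 2 ∂(O.fst.prod O.snd) ≤ C * (n : ℝ) ^ (-a))} ≤
          ENNReal.ofReal ε := by
  obtain ⟨C, hC0, hC⟩ := exists_integral_sup_excessDeviation_le hV hindep hlaw hRm hVC hB hbdd hr₀
    hO hpos ha0 ha1
  obtain ⟨D, hDR, hDc, hD⟩ := hsep
  have hDne : D.Nonempty := by
    obtain ⟨r', hr', -⟩ := hD r₀ hr₀ 1 one_pos
    exact ⟨r', hr'⟩
  obtain ⟨e, he⟩ := hDc.exists_eq_range hDne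
  have heR : ∀ k, e k ∈ R := fun k => hDR (he ▸ Set.mem_range_self k)
  refine ⟨2 * (C / ε) + 4 * B ^ 2, by positivity, ?_⟩
  filter_upwards [eventually_ge_atTop 2] with n hn
  have hn1 : (1 : ℝ) ≤ n := by exact_mod_cast (by omega : 1 ≤ n)
  have hn0 : (0 : ℝ) < n := by linarith
  have hna : (0 : ℝ) < (n : ℝ) ^ (-a) := Real.rpow_pos_of_pos hn0 _
  set t : ℝ := C / ε * (n : ℝ) ^ (-a) with ht
  have ht0 : 0 < t := by positivity
  have htail := measure_exists_lt_excessDeviation_le hV hRm hbdd hr₀ hn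
    (fun F hF => hC n hn F hF) (fun k => ⟨e k, heR k⟩) ht0
  have hratio : C * (n : ℝ) ^ (-a) / t = ε := by
    rw [ht]
    field_simp
  rw [hratio] at htail
  refine (measure_mono_ae ?_).trans htail
  filter_upwards [hrhat n (by omega)] with ω hω
  obtain ⟨hR, hmin⟩ := hω
  intro hbad
  by_contra hgood
  refine hbad ⟨hR, ?_⟩
  have hgood' : ∀ k, excessDeviation O r₀ (fun i : Fin n => V i ω) (e k) ≤ t := fun k =>
    not_lt.mp fun h => hgood ⟨k, h⟩
  -- The deviation bound passes from the countable dense subclass to the estimator.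
  have hdev : excessDeviation O r₀ (fun i : Fin n => V i ω) (rhat n ω) ≤ t := by
    refine le_of_forall_pos_le_add fun δ hδ => ?_
    obtain ⟨r', hr', hclose⟩ := hD _ hR (δ / (3 * (1 + B))) (by positivity)
    obtain ⟨k, rfl⟩ : r' ∈ Set.range e := he ▸ hr'
    refine (excessDeviation_le_add (hRm _ hr₀) (hRm _ hR) (hRm _ (heR k)) (hbdd _ hr₀) (hbdd _ hR)
      (hbdd _ (heR k)) hn _ hclose).trans ?_
    have h1 : 3 * ((1 + B) * (δ / (3 * (1 + B)))) = δ := by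
      field_simp
    rw [h1]
    linarith [hgood' k]
  have hU := uStatistic_excessLoss_le hn (hbdd _ hr₀) (hbdd _ hR) (fun i => (V i ω).1)
    (fun i => (V i ω).2)
  have hmin' := isMinOn_iff.mp hmin r₀ hr₀
  have hnle : B ^ 2 / n ≤ B ^ 2 * (n : ℝ) ^ (-a) := by
    rw [div_eq_mul_inv, ← Real.rpow_neg_one]
    exact mul_le_mul_of_nonneg_left (Real.rpow_le_rpow_of_exponent_le hn1 (by linarith))
      (sq_nonneg B)
  unfold excessDeviation at hdev
  rw [integral_excessLoss (hRm _ hr₀) hO hpos (hRm _ hR) (hbdd _ hr₀) (hbdd _ hR)] at hdev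
  simp only [Prod.mk.eta] at hU
  have : (2 * (C / ε) + 4 * B ^ 2) * (n : ℝ) ^ (-a) = 2 * t + 4 * (B ^ 2 * (n : ℝ) ^ (-a)) := by
    rw [ht]
    ring
  rw [this]
  linarith

end Rate

theorem lemma1 {Ω 𝒴 𝒳 𝒵 : Type*} [MeasurableSpace Ω] [MeasurableSpace 𝒴] [MeasurableSpace 𝒳]
    [MeasurableSpace 𝒵] (Pr : Measure Ω) [IsProbabilityMeasure Pr]
    -- the i.i.d. sample, with law `O`
    (Y : ℕ → Ω → 𝒴) (X : ℕ → Ω → 𝒳) (Z : ℕ → Ω → 𝒵)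
    (hY : ∀ i, Measurable (Y i)) (hX : ∀ i, Measurable (X i)) (hZ : ∀ i, Measurable (Z i))
    (O : Measure ((𝒴 × 𝒳) × 𝒵))
    (hindep : iIndepFun (fun i ω => ((Y i ω, X i ω), Z i ω)) Pr)
    (hlaw : ∀ i, Pr.map (fun ω => ((Y i ω, X i ω), Z i ω)) = O)
    -- the density of `O` and the conditional density ratio
    (μ : Measure (𝒴 × 𝒳)) [SigmaFinite μ] (ν : Measure 𝒵) [SigmaFinite ν]
    (p : (𝒴 × 𝒳) × 𝒵 → ℝ≥0∞) (hp : Measurable p) (hO : O = (μ.prod ν).withDensity p)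
    (rstar : (𝒴 × 𝒳) × 𝒵 → ℝ)
    (hrstar : rstar =ᵐ[O.fst.prod O.snd] densityRatio μ ν p)
    -- the hypothesis class
    (R : Set ((𝒴 × 𝒳) × 𝒵 → ℝ)) (hRmeas : ∀ r ∈ R, Measurable r)
    (hVC : IsVCFunctionClass R) (hmem : rstar ∈ R)
    (B : ℝ) (hB : 0 < B) (hbdd : ∀ r ∈ R, ∀ q, |r q| ≤ B)
    -- its stratification and the entropy bound
    (I : ((𝒴 × 𝒳) × 𝒵 → ℝ) → ℝ≥0∞) (hI : I rstar < ∞)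
    (hstrat : R = ⋃ (M : ℝ) (_ : 1 ≤ M), stratum R I M)
    (γ : ℝ) (hγ0 : 0 < γ) (hγ2 : γ < 2)
    (A : ℝ)
    (hent : ∀ M : ℝ, 1 ≤ M → ∀ δ : ℝ≥0, 0 < δ →
      ENNReal.log (supCoveringNumber δ (stratum R I M) : ℝ≥0∞) ≤ ((A * (M / δ) ^ γ : ℝ) : EReal))
    -- the estimator
    (rhat : ℕ → Ω → (𝒴 × 𝒳) × 𝒵 → ℝ)
    (hrhat : ∀ n, 1 ≤ n → ∀ᵐ ω ∂Pr, rhat n ω ∈ R ∧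
      IsMinOn (lsifRisk n (fun i => (Y i ω, X i ω)) (fun i => Z i ω)) R (rhat n ω)) :
    IsBigOInProbability Pr (fun n ω => eLpNorm (rhat n ω - rstar) 2 O)
        (fun n => (n : ℝ) ^ (-(1 / (2 + γ)))) ∧
      IsBigOInProbability Pr (fun n ω => eLpNorm (rhat n ω - rstar) 2 (O.fst.prod O.snd))
        (fun n => (n : ℝ) ^ (-(1 / (2 + γ)))) := by
  set V : ℕ → Ω → (𝒴 × 𝒳) × 𝒵 := fun i ω => ((Y i ω, X i ω), Z i ω) with hVdef
  have hV : ∀ i, Measurable (V i) := fun i => ((hY i).prodMk (hX i)).prodMk (hZ i)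
  have hOprob : IsProbabilityMeasure O := by
    rw [← hlaw 0]
    exact Measure.isProbabilityMeasure_map (hV 0).aemeasurable
  have hfin : IsFiniteMeasure ((μ.prod ν).withDensity p) := hO ▸ inferInstance
  have hdens : (O.fst.prod O.snd).withDensity (fun q => ENNReal.ofReal (rstar q)) = O := by
    have h1 : (fun q => ENNReal.ofReal (rstar q)) =ᵐ[O.fst.prod O.snd]
        fun q => ENNReal.ofReal (densityRatio μ ν p q) := hrstar.fun_comp ENNReal.ofReal
    rw [withDensity_congr_ae h1, hO]
    exact withDensity_densityRatio μ ν hp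
  have hpos : ∀ᵐ q ∂(O.fst.prod O.snd), 0 ≤ rstar q := by
    filter_upwards [hrstar] with q hq
    rw [hq]
    exact ENNReal.toReal_nonneg
  have ha1 : 2 / (2 + γ) < 1 := by
    rw [div_lt_one (by linarith)]
    linarith
  have htail : ∀ ε : ℝ, 0 < ε → ∃ C : ℝ, 0 < C ∧ ∀ᶠ n : ℕ in atTop,
      Pr {ω | ¬ (rhat n ω ∈ R ∧ ∫ q, (rhat n ω q - rstar q) ^ 2 ∂(O.fst.prod O.snd) ≤
        C * (n : ℝ) ^ (2 * -(1 / (2 + γ))))} ≤ ENNReal.ofReal ε := by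
    intro ε hε
    have h1 : 2 * -(1 / (2 + γ)) = -(2 / (2 + γ)) := by ring
    rw [h1]
    exact exists_measure_lt_integral_sq_le hV hindep hlaw hRmeas hVC hB hbdd hmem hdens hpos
      (exists_countable_dense_of_entropy hstrat hent) hrhat (by positivity) ha1 hε
  refine ⟨isBigOInProbability_of_integral_sq hRmeas hbdd hmem hB (fun r hr => ?_) htail,
    isBigOInProbability_of_integral_sq hRmeas hbdd hmem one_pos (fun r _ => ?_) htail⟩
  · exact integral_sq_sub_le (hRmeas _ hmem) hdens hpos (hRmeas _ hr) (hbdd _ hmem) (hbdd _ hr)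
  · rw [one_mul]
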